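/- A \emph{Type $\mathcal A$ model} is an affine surface $\mathcal M(\xi)=(\mathbb R^2,\nabla)$, $\xi\in\mathbb R^8$, whose Christoffel symbols ($\nabla_{\partial_i}\partial_j=\Gamma_{ij}{}^k\partial_k$) are the constants $$(\Gamma_{11}{}^1,\Gamma_{11}{}^2,\Gamma_{12}{}^1,\Gamma_{12}{}^2,\Gamma_{21}{}^1,\Gamma_{21}{}^2,\Gamma_{22}{}^1,\Gamma_{22}{}^2)=(\xi_1,\dots,\xi_8);$$ $\nabla$ may have torsion, with components $T^i=\tfrac12(\Gamma_{12}{}^i-\Gamma_{21}{}^i)$. Let $\mathfrak K(\mathcal M)$ be the Lie algebra (under the Lie bracket) of affine Killing vector fields, i.e. of the smooth vector fields $v=v^k\partial_k$ on $\mathbb R^2$ with $$\partial_i\partial_jv^k+v^l\partial_l\Gamma_{ij}{}^k-\Gamma_{ij}{}^l\partial_lv^k+\Gamma_{il}{}^k\partial_jv^l+\Gamma_{lj}{}^k\partial_iv^l=0\qquad(1\le i,j,k\le 2).$$ Two Type $\mathcal A$ models are \emph{linearly equivalent} if a linear change of coordinates of $\mathbb R^2$ carries one connection to the other. Consider the Lie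 algebras given by the following nonzero brackets: $\mathfrak K_{\mathcal A}$ abelian of dimension 2; $\mathfrak K_{\mathcal B}$ of dimension 2, $[e_1,e_2]=e_1$; $A^0_{4,9}$ of dimension 4, $[e_2,e_3]=e_1$, $[e_1,e_4]=e_1$, $[e_2,e_4]=e_2$; $A_{4,12}$ of dimension 4, $[e_1,e_3]=e_1$, $[e_2,e_3]=e_2$, $[e_1,e_4]=-e_2$, $[e_2,e_4]=e_1$; and let $\mathbb A_6$ be the Lie algebra of the full affine group of the plane. For $T=(T^1,T^2)\in\mathbb R^2$ and $c\in\mathbb R$ put $$\begin{aligned} \mathcal M^6_0(T)&=\mathcal M(0,0,T^1,T^2,-T^1,-T^2,0,0),& \mathcal M^6_1(T)&=\mathcal M(1,0,T^1,1+T^2,-T^1,1-T^2,0,0),\\ \mathcal M^6_2(T)&=\mathcal M(-1,0,T^1,T^2,-T^1,-T^2,0,1),& \mathcal M^6_3(T)&=\mathcal M(0,0,T^1,T^2,-T^1,-T^2,0,1),\\ \mathcal M^6_4(T)&=\mathcal M(0,0,T^1,T^2,-T^1,-T^2,1,0),& \mathcal M^6_5(T)&=\mathcal M(1,0,T^1,1+T^2,-T^1,1-T^2,-1,0),\\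 \mathcal M^4_1(T)&=\mathcal M(-1,0,1+T^1,T^2,1-T^1,-T^2,0,2),& \mathcal M^4_2(c;T)&=\mathcal M(-1,0,c+T^1,T^2,c-T^1,-T^2,0,1+2c),\\ \mathcal M^4_3(c;T)&=\mathcal M(0,0,c+T^1,T^2,c-T^1,-T^2,0,1+2c),& \mathcal M^4_4(c;T)&=\mathcal M(0,0,1+T^1,T^2,1-T^1,-T^2,c,2),\\ \mathcal M^4_5(c;T)&=\mathcal M(1,0,T^1,T^2,-T^1,-T^2,1+c^2,2c), \end{aligned}$$ where $c\ne0,-1$ in $\mathcal M^4_2$ and $\mathcal M^4_3$. Then: (a) Generically $\mathfrak K(\mathcal M(\xi))=\operatorname{span}\{\partial_1,\partial_2\}\cong\mathfrak K_{\mathcal A}$: there is a nonzero real polynomial $p$ in 8 variables such that this holds for all $\xi$ with $p(\xi)\ne0$. Moreover it holds for every $\xi$ with $\dim\mathfrak K(\mathcal M(\xi))\le2$. (b) For $\varepsilon\neq0$, $(\varepsilon_1,\varepsilon_2)\ne(0,0)$, arbitrary $T^1\in\mathbb R$ and all admissible $c$: 1. $\mathbb A_6\cong\mathfrak K(\mathcal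 M^6_i(0,0))$ for $0\le i\le5$; 2. $\mathfrak K_{\mathcal B}\oplus\mathfrak K_{\mathcal B}\cong\mathfrak K(\mathcal M^6_1(0,\varepsilon))\cong\mathfrak K(\mathcal M^6_2(0,\varepsilon))\cong\mathfrak K(\mathcal M^6_2(\varepsilon,0))\cong\mathfrak K(\mathcal M^6_3(\varepsilon,0))\cong\mathfrak K(\mathcal M^4_2(c;(T^1,0)))\cong\mathfrak K(\mathcal M^4_3(c;(T^1,0)))$; 3. $A^0_{4,9}\cong\mathfrak K(\mathcal M^6_0(\varepsilon_1,\varepsilon_2))\cong\mathfrak K(\mathcal M^6_3(0,\varepsilon))\cong\mathfrak K(\mathcal M^6_4(\varepsilon,0))\cong\mathfrak K(\mathcal M^4_1(T^1,0))\cong\mathfrak K(\mathcal M^4_4(c;(T^1,0)))$; 4. $A_{4,12}\cong\mathfrak K(\mathcal M^4_5(c;(T^1,0)))$. (c) Every Type $\mathcal A$ model $\mathcal M$ with $\dim\mathfrak K(\mathcal M)>2$ is linearly equivalent to a model listed in (b), and $\mathfrak K(\mathcal M)$ is isomorphic to the Lie algebra under which that model is listed. The algebra $\mathbb A_6$ occurs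 here only for torsion-free $\mathcal M$; so if $\mathcal M$ has nonzero torsion, $\mathfrak K(\mathcal M)$ is isomorphic to $\mathfrak K_{\mathcal B}\oplus\mathfrak K_{\mathcal B}$, $A^0_{4,9}$ or $A_{4,12}$. -/

import Mathlib

open scoped ContDiff

attribute [local instance 100] LieRing.ofAssociativeRing

noncomputable section

/-! ## Smooth vector fields on the plane -/

/-- The plane `ℝ²` with its coordinates `(x¹, x²) = (x 0, x 1)`. -/
abbrev Plane : Type := Fin 2 → ℝ

/-- The partial derivative `∂_i f`. -/
def pd (i : Fin 2) (f : Plane → ℝ) : Plane → ℝ :=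
  fun x => fderiv ℝ f x (Pi.single i 1)

/-- The real vector space of smooth vector fields `v = v¹ ∂₁ + v² ∂₂` on the plane. -/
def smoothFields : Submodule ℝ (Plane → Plane) where
  carrier := {v | ContDiff ℝ ∞ v}
  add_mem' {v w} hv hw := by
    rw [Set.mem_ofPred_eq] at *
    exact hv.add hw
  zero_mem' := by
    rw [Set.mem_ofPred_eq]
    exact contDiff_const
  smul_mem' c v hv := by
    rw [Set.mem_ofPred_eq] at *
    exact hv.const_smul c

lemma mem_smoothFields {v : Plane → Plane} : v ∈ smoothFields ↔ ContDiff ℝ ∞ v := Iff.rfl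

/-- The smooth vector fields on the plane, as a type. -/
abbrev SmoothField : Type := ↥smoothFields

lemma SmoothField.contDiff (v : SmoothField) : ContDiff ℝ ∞ v.1 := v.2

lemma SmoothField.differentiableAt (v : SmoothField) (x : Plane) :
    DifferentiableAt ℝ v.1 x :=
  (v.contDiff.differentiable (by simp)).differentiableAt

lemma two_le_smooth : (2 : WithTop ℕ∞) ≤ ∞ :=
  WithTop.coe_le_coe.2 (le_top : (2 : ℕ∞) ≤ ⊤)

/-- The Lie bracket of vector fields. -/
instance : Bracket SmoothField SmoothField where
  bracket v w :=
    ⟨VectorField.lieBracket ℝ v.1 w.1,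
      mem_smoothFields.2 (ContDiff.lieBracket_vectorField (n := ∞) v.contDiff w.contDiff le_rfl)⟩

lemma SmoothField.coe_bracket (v w : SmoothField) :
    (⁅v, w⁆ : SmoothField).1 = VectorField.lieBracket ℝ v.1 w.1 := rfl

instance : LieRing SmoothField where
  add_lie u v w := by
    apply Subtype.ext
    funext x
    exact VectorField.lieBracket_add_left (u.differentiableAt x) (v.differentiableAt x)
  lie_add u v w := by
    apply Subtype.ext
    funext x
    exact VectorField.lieBracket_add_right (v.differentiableAt x) (w.differentiableAt x)
  lie_self u := by
    apply Subtype.ext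
    exact VectorField.lieBracket_self
  leibniz_lie u v w := by
    apply Subtype.ext
    funext x
    exact VectorField.leibniz_identity_lieBracket (n := ∞)
      (by simpa using two_le_smooth)
      u.contDiff.contDiffAt v.contDiff.contDiffAt w.contDiff.contDiffAt

instance : LieAlgebra ℝ SmoothField where
  lie_smul c u v := by
    apply Subtype.ext
    funext x
    exact VectorField.lieBracket_const_smul_right (v.differentiableAt x)

/-- The coordinate vector field `∂_i`. -/
def coordField (i : Fin 2) : SmoothField :=
  ⟨fun _ => Pi.single i 1, mem_smoothFields.2 contDiff_const⟩

/-! ## Connections on the plane and affine Killing vector fields -/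

/-- A smooth connection on the tangent bundle of the plane, possibly with torsion, given by its
Christoffel symbols: `∇_{∂_i} ∂_j = ∑ k, Γ i j k ∂_k`. -/
structure PlaneConnection where
  /-- `Γ i j k` is the Christoffel symbol with lower indices `i`, `j` and upper index `k`. -/
  Γ : Fin 2 → Fin 2 → Fin 2 → Plane → ℝ
  smooth : ∀ i j k, ContDiff ℝ ∞ (Γ i j k)

/-- The component `(i, j, k)` of the Lie derivative of the connection along `v`. -/
def killingTensor (C : PlaneConnection) (v : Plane → Plane) (i j k : Fin 2) (x : Plane) : ℝ :=
  pd i (pd j (fun y => v y k)) x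
    + ∑ l, v x l * pd l (C.Γ i j k) x
    - ∑ l, C.Γ i j l x * pd l (fun y => v y k) x
    + ∑ l, C.Γ i l k x * pd j (fun y => v y l) x
    + ∑ l, C.Γ l j k x * pd i (fun y => v y l) x

/-- The affine Killing equations. -/
def IsAffineKilling (C : PlaneConnection) (v : Plane → Plane) : Prop :=
  ∀ i j k x, killingTensor C v i j k x = 0

/-! ### Calculus rules needed to see that the solutions form a Lie algebra -/

lemma pd_add {f g : Plane → ℝ} (hf : ContDiff ℝ ∞ f) (hg : ContDiff ℝ ∞ g) (i : Fin 2) :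
    pd i (fun y => f y + g y) = fun y => pd i f y + pd i g y := by
  funext x
  have h1 := (hf.differentiable (by simp)).differentiableAt (x := x)
  have h2 := (hg.differentiable (by simp)).differentiableAt (x := x)
  simp [pd, fderiv_fun_add h1 h2]

lemma pd_sub {f g : Plane → ℝ} (hf : ContDiff ℝ ∞ f) (hg : ContDiff ℝ ∞ g) (i : Fin 2) :
    pd i (fun y => f y - g y) = fun y => pd i f y - pd i g y := by
  funext x
  have h1 := (hf.differentiable (by simp)).differentiableAt (x := x)
  have h2 := (hg.differentiable (by simp)).differentiableAt (x := x)
  simp [pd, fderiv_fun_sub h1 h2]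

lemma pd_mul {f g : Plane → ℝ} (hf : ContDiff ℝ ∞ f) (hg : ContDiff ℝ ∞ g) (i : Fin 2) :
    pd i (fun y => f y * g y) = fun y => f y * pd i g y + g y * pd i f y := by
  funext x
  have h1 := (hf.differentiable (by simp)).differentiableAt (x := x)
  have h2 := (hg.differentiable (by simp)).differentiableAt (x := x)
  simp [pd, fderiv_fun_mul h1 h2]

lemma pd_zero (i : Fin 2) : pd i (fun _ => (0 : ℝ)) = fun _ => 0 := by
  funext x
  simp [pd]

lemma pd_const_mul {f : Plane → ℝ} (hf : ContDiff ℝ ∞ f) (c : ℝ) (i : Fin 2) :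
    pd i (fun y => c * f y) = fun y => c * pd i f y := by
  funext x
  have h1 := (hf.differentiable (by simp)).differentiableAt (x := x)
  simp [pd, fderiv_const_mul h1]

lemma contDiff_pd {f : Plane → ℝ} (hf : ContDiff ℝ ∞ f) (i : Fin 2) :
    ContDiff ℝ ∞ (pd i f) :=
  (hf.fderiv_right (m := ∞) (by simp)).clm_apply contDiff_const

lemma pd_comm {f : Plane → ℝ} (hf : ContDiff ℝ ∞ f) (i j : Fin 2) :
    pd i (pd j f) = pd j (pd i f) := by
  funext x
  have hd : DifferentiableAt ℝ (fderiv ℝ f) x :=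
    ((hf.fderiv_right (m := ∞) (by simp)).differentiable (by simp)).differentiableAt
  have key : ∀ a b : Fin 2,
      pd a (pd b f) x = fderiv ℝ (fderiv ℝ f) x (Pi.single a 1) (Pi.single b 1) := by
    intro a b
    change fderiv ℝ (fun y => fderiv ℝ f y (Pi.single b 1)) x (Pi.single a 1) = _
    rw [fderiv_clm_apply hd (differentiableAt_const _)]
    simp
  rw [key, key]
  exact (hf.contDiffAt.isSymmSndFDerivAt (by simpa using two_le_smooth)) _ _

lemma contDiff_component {v : Plane → Plane} (hv : ContDiff ℝ ∞ v) (k : Fin 2) :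
    ContDiff ℝ ∞ (fun y => v y k) := contDiff_pi.1 hv k

lemma fderiv_apply_component {w : Plane → Plane} (hw : ContDiff ℝ ∞ w) (x a : Plane)
    (k : Fin 2) :
    fderiv ℝ w x a k = a 0 * pd 0 (fun y => w y k) x + a 1 * pd 1 (fun y => w y k) x := by
  have hd : ∀ m, DifferentiableAt ℝ (fun y => w y m) x := fun m =>
    ((contDiff_component hw m).differentiable (by simp)).differentiableAt
  have h1 : fderiv ℝ w x a k = fderiv ℝ (fun y => w y k) x a := by
    rw [fderiv_pi hd]
    rfl
  have h2 : a = a 0 • (Pi.single 0 1 : Plane) + a 1 • (Pi.single 1 1 : Plane) := by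
    ext m
    fin_cases m <;> simp
  rw [h1]
  conv_lhs => rw [h2]
  rw [map_add, map_smul, map_smul]
  rfl

lemma lieBracket_component {v w : Plane → Plane} (hv : ContDiff ℝ ∞ v) (hw : ContDiff ℝ ∞ w)
    (k : Fin 2) :
    (fun y => VectorField.lieBracket ℝ v w y k) =
      fun y => (v y 0 * pd 0 (fun z => w z k) y + v y 1 * pd 1 (fun z => w z k) y)
        - (w y 0 * pd 0 (fun z => v z k) y + w y 1 * pd 1 (fun z => v z k) y) := by
  funext y
  rw [VectorField.lieBracket_eq]
  simp only [Pi.sub_apply]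
  rw [fderiv_apply_component hw, fderiv_apply_component hv]

/-- Differentiating the affine Killing equations. -/
lemma killing_deriv (C : PlaneConnection) {v : Plane → Plane}
    (hv : ContDiff ℝ ∞ v) (kv : IsAffineKilling C v) (m i j k : Fin 2) (x : Plane) :
    pd m (pd i (pd j (fun y => v y k))) x
      + ∑ l, (v x l * pd m (pd l (C.Γ i j k)) x + pd l (C.Γ i j k) x * pd m (fun y => v y l) x)
      - ∑ l, (C.Γ i j l x * pd m (pd l (fun y => v y k)) x
          + pd l (fun y => v y k) x * pd m (C.Γ i j l) x)
      + ∑ l, (C.Γ i l k x * pd m (pd j (fun y => v y l)) x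
          + pd j (fun y => v y l) x * pd m (C.Γ i l k) x)
      + ∑ l, (C.Γ l j k x * pd m (pd i (fun y => v y l)) x
          + pd i (fun y => v y l) x * pd m (C.Γ l j k) x) = 0 := by
  have hc := contDiff_component hv
  have hp := fun k i => contDiff_pd (hc k) i
  have hpp := fun k i j => contDiff_pd (hp k i) j
  have hG := C.smooth
  have hpG := fun i j k l => contDiff_pd (hG i j k) l
  have h0 : killingTensor C v i j k = fun _ => 0 := funext fun y => kv i j k y
  have h1 : pd m (killingTensor C v i j k) x = 0 := by rw [h0, pd_zero]
  rw [← h1]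
  unfold killingTensor
  simp only [Fin.sum_univ_two]
  simp (disch := fun_prop) only [pd_add, pd_sub, pd_mul]

lemma killing_bracket (C : PlaneConnection) {v w : Plane → Plane}
    (hv : ContDiff ℝ ∞ v) (hw : ContDiff ℝ ∞ w)
    (kv : IsAffineKilling C v) (kw : IsAffineKilling C w) :
    IsAffineKilling C (VectorField.lieBracket ℝ v w) := by
  have dv := killing_deriv C hv kv
  have dw := killing_deriv C hw kw
  have hvc := contDiff_component hv
  have hvp := fun k i => contDiff_pd (hvc k) i
  have hvpp := fun k i j => contDiff_pd (hvp k i) j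
  have hwc := contDiff_component hw
  have hwp := fun k i => contDiff_pd (hwc k) i
  have hwpp := fun k i j => contDiff_pd (hwp k i) j
  have hG := C.smooth
  have hpG := fun i j k l => contDiff_pd (hG i j k) l
  have pd10 : ∀ {f : Plane → ℝ}, ContDiff ℝ ∞ f → pd 1 (pd 0 f) = pd 0 (pd 1 f) :=
    fun hf => pd_comm hf 1 0
  intro i j k x
  have Ev := fun i j k => kv i j k x
  have Ew := fun i j k => kw i j k x
  have Dv := dv 0 i j k x
  have Dv' := dv 1 i j k x
  have Dw := dw 0 i j k x
  have Dw' := dw 1 i j k x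
  clear dv dw kv kw
  unfold killingTensor at Ev Ew ⊢
  simp only [lieBracket_component hv hw, Fin.sum_univ_two] at Ev Ew Dv Dv' Dw Dw' ⊢
  have hb := fun l => congrFun (lieBracket_component hv hw l) x
  simp only [hb]
  simp (disch := fun_prop) only [pd_add, pd_sub, pd_mul]
  clear hb
  have Ev1 := Ev 0 j k
  have Ev2 := Ev 1 j k
  have Ev3 := Ev i 0 k
  have Ev4 := Ev i 1 k
  have Ev5 := Ev i j 0
  have Ev6 := Ev i j 1
  have Ew1 := Ew 0 j k
  have Ew2 := Ew 1 j k
  have Ew3 := Ew i 0 k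
  have Ew4 := Ew i 1 k
  have Ew5 := Ew i j 0
  have Ew6 := Ew i j 1
  clear Ev Ew
  have two : ∀ a : Fin 2, a = 0 ∨ a = 1 := by decide
  rcases two i with rfl | rfl <;> rcases two j with rfl | rfl
  · simp (disch := fun_prop) only [pd10] at Dv Dv' Dw Dw' Ev1 Ev2 Ev3 Ev4 Ev5 Ev6 Ew1 Ew2 Ew3 Ew4 Ew5 Ew6 ⊢
    linear_combination v x 0 * Dw + v x 1 * Dw' - w x 0 * Dv - w x 1 * Dv'
      + pd 0 (fun y => v y 0) x * Ew1
      + pd 0 (fun y => v y 1) x * Ew2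
      + pd 0 (fun y => v y 0) x * Ew3
      + pd 0 (fun y => v y 1) x * Ew4
      - pd 0 (fun y => v y k) x * Ew5 - pd 1 (fun y => v y k) x * Ew6
      - pd 0 (fun y => w y 0) x * Ev1
      - pd 0 (fun y => w y 1) x * Ev2
      - pd 0 (fun y => w y 0) x * Ev3
      - pd 0 (fun y => w y 1) x * Ev4
      + pd 0 (fun y => w y k) x * Ev5 + pd 1 (fun y => w y k) x * Ev6
  · simp (disch := fun_prop) only [pd10] at Dv Dv' Dw Dw' Ev1 Ev2 Ev3 Ev4 Ev5 Ev6 Ew1 Ew2 Ew3 Ew4 Ew5 Ew6 ⊢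
    linear_combination v x 0 * Dw + v x 1 * Dw' - w x 0 * Dv - w x 1 * Dv'
      + pd 0 (fun y => v y 0) x * Ew1
      + pd 0 (fun y => v y 1) x * Ew2
      + pd 1 (fun y => v y 0) x * Ew3
      + pd 1 (fun y => v y 1) x * Ew4
      - pd 0 (fun y => v y k) x * Ew5 - pd 1 (fun y => v y k) x * Ew6
      - pd 0 (fun y => w y 0) x * Ev1
      - pd 0 (fun y => w y 1) x * Ev2
      - pd 1 (fun y => w y 0) x * Ev3
      - pd 1 (fun y => w y 1) x * Ev4
      + pd 0 (fun y => w y k) x * Ev5 + pd 1 (fun y => w y k) x * Ev6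
  · simp (disch := fun_prop) only [pd10] at Dv Dv' Dw Dw' Ev1 Ev2 Ev3 Ev4 Ev5 Ev6 Ew1 Ew2 Ew3 Ew4 Ew5 Ew6 ⊢
    linear_combination v x 0 * Dw + v x 1 * Dw' - w x 0 * Dv - w x 1 * Dv'
      + pd 1 (fun y => v y 0) x * Ew1
      + pd 1 (fun y => v y 1) x * Ew2
      + pd 0 (fun y => v y 0) x * Ew3
      + pd 0 (fun y => v y 1) x * Ew4
      - pd 0 (fun y => v y k) x * Ew5 - pd 1 (fun y => v y k) x * Ew6
      - pd 1 (fun y => w y 0) x * Ev1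
      - pd 1 (fun y => w y 1) x * Ev2
      - pd 0 (fun y => w y 0) x * Ev3
      - pd 0 (fun y => w y 1) x * Ev4
      + pd 0 (fun y => w y k) x * Ev5 + pd 1 (fun y => w y k) x * Ev6
  · simp (disch := fun_prop) only [pd10] at Dv Dv' Dw Dw' Ev1 Ev2 Ev3 Ev4 Ev5 Ev6 Ew1 Ew2 Ew3 Ew4 Ew5 Ew6 ⊢
    linear_combination v x 0 * Dw + v x 1 * Dw' - w x 0 * Dv - w x 1 * Dv'
      + pd 1 (fun y => v y 0) x * Ew1
      + pd 1 (fun y => v y 1) x * Ew2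
      + pd 1 (fun y => v y 0) x * Ew3
      + pd 1 (fun y => v y 1) x * Ew4
      - pd 0 (fun y => v y k) x * Ew5 - pd 1 (fun y => v y k) x * Ew6
      - pd 1 (fun y => w y 0) x * Ev1
      - pd 1 (fun y => w y 1) x * Ev2
      - pd 1 (fun y => w y 0) x * Ev3
      - pd 1 (fun y => w y 1) x * Ev4
      + pd 0 (fun y => w y k) x * Ev5 + pd 1 (fun y => w y k) x * Ev6

/-- The Lie algebra `𝔎(M)` of the affine Killing vector fields of the affine surface
`M = (ℝ², ∇)`, with the Lie bracket of vector fields. -/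
def killingAlgebra (C : PlaneConnection) : LieSubalgebra ℝ SmoothField where
  carrier := {v | IsAffineKilling C v.1}
  zero_mem' := by
    rw [Set.mem_ofPred_eq]
    intro i j k x
    simp [killingTensor, pd_zero]
  add_mem' {v w} hv hw := by
    rw [Set.mem_ofPred_eq] at *
    intro i j k x
    have h1 := hv i j k x
    have h2 := hw i j k x
    have hvc := contDiff_component v.contDiff
    have hwc := contDiff_component w.contDiff
    have hvp := fun k i => contDiff_pd (hvc k) i
    have hwp := fun k i => contDiff_pd (hwc k) i
    unfold killingTensor at h1 h2 ⊢
    simp only [Fin.sum_univ_two, Submodule.coe_add, Pi.add_apply] at h1 h2 ⊢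
    simp (disch := fun_prop) only [pd_add]
    linear_combination h1 + h2
  smul_mem' c v hv := by
    rw [Set.mem_ofPred_eq] at *
    intro i j k x
    have h1 := hv i j k x
    have hvc := contDiff_component v.contDiff
    have hvp := fun k i => contDiff_pd (hvc k) i
    unfold killingTensor at h1 ⊢
    simp only [Fin.sum_univ_two, Submodule.coe_smul, Pi.smul_apply, smul_eq_mul] at h1 ⊢
    simp (disch := fun_prop) only [pd_const_mul]
    linear_combination c * h1
  lie_mem' {v w} hv hw := killing_bracket C v.contDiff w.contDiff hv hw

/-! ## Type A models -/

/-- The constant Christoffel symbols with parameter `ξ ∈ ℝ⁸`, in the order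
`Γ₁₁¹, Γ₁₁², Γ₁₂¹, Γ₁₂², Γ₂₁¹, Γ₂₁², Γ₂₂¹, Γ₂₂²`; the last argument is the upper index. -/
def christoffelA (ξ : Fin 8 → ℝ) (i j k : Fin 2) : ℝ :=
  ![![![ξ 0, ξ 1], ![ξ 2, ξ 3]], ![![ξ 4, ξ 5], ![ξ 6, ξ 7]]] i j k

/-- The Type A model `M(ξ) = (ℝ², ∇)` with constant Christoffel symbols `ξ`. -/
def modelA (ξ : Fin 8 → ℝ) : PlaneConnection where
  Γ i j k := fun _ => christoffelA ξ i j k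
  smooth _ _ _ := contDiff_const

/-- The Lie algebra of affine Killing vector fields of the Type A model `M(ξ)`. -/
def killingA (ξ : Fin 8 → ℝ) : LieSubalgebra ℝ SmoothField :=
  killingAlgebra (modelA ξ)

/-- The component `Tⁱ = (Γ₁₂ⁱ - Γ₂₁ⁱ) / 2` of the torsion tensor of `M(ξ)`. -/
def torsionA (ξ : Fin 8 → ℝ) (i : Fin 2) : ℝ :=
  (christoffelA ξ 0 1 i - christoffelA ξ 1 0 i) / 2

/-- Two Type A models are linearly equivalent if a linear change of coordinates `y = P x` takes
the first connection to the second one, `P (∇_a b) = ∇'_{P a} (P b)`; that is, they lie in the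
same orbit of the action of `GL(2, ℝ)` on the parameter space. -/
def LinEquivA (ξ η : Fin 8 → ℝ) : Prop :=
  ∃ P : GL (Fin 2) ℝ, ∀ i j k : Fin 2,
    ∑ l, P.1 k l * christoffelA ξ i j l =
      ∑ p, ∑ q, P.1 p i * P.1 q j * christoffelA η p q k

/-- The translations `span {∂₁, ∂₂}` inside the space of smooth vector fields. -/
def translations : Submodule ℝ SmoothField :=
  Submodule.span ℝ {coordField 0, coordField 1}

/-! ### The families of models

In each case `a` and `b` are the components `T¹` and `T²` of the torsion tensor. -/

/-- `M⁶₀(T)` -/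
def M60 (a b : ℝ) : Fin 8 → ℝ := ![0, 0, a, b, -a, -b, 0, 0]

/-- `M⁶₁(T)` -/
def M61 (a b : ℝ) : Fin 8 → ℝ := ![1, 0, a, 1 + b, -a, 1 - b, 0, 0]

/-- `M⁶₂(T)` -/
def M62 (a b : ℝ) : Fin 8 → ℝ := ![-1, 0, a, b, -a, -b, 0, 1]

/-- `M⁶₃(T)` -/
def M63 (a b : ℝ) : Fin 8 → ℝ := ![0, 0, a, b, -a, -b, 0, 1]

/-- `M⁶₄(T)` -/
def M64 (a b : ℝ) : Fin 8 → ℝ := ![0, 0, a, b, -a, -b, 1, 0]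

/-- `M⁶₅(T)` -/
def M65 (a b : ℝ) : Fin 8 → ℝ := ![1, 0, a, 1 + b, -a, 1 - b, -1, 0]

/-- `M⁴₁(T)` -/
def M41 (a b : ℝ) : Fin 8 → ℝ := ![-1, 0, 1 + a, b, 1 - a, -b, 0, 2]

/-- `M⁴₂(c; T)`, considered for `c ≠ 0, -1` -/
def M42 (c a b : ℝ) : Fin 8 → ℝ := ![-1, 0, c + a, b, c - a, -b, 0, 1 + 2 * c]

/-- `M⁴₃(c; T)`, considered for `c ≠ 0, -1` -/
def M43 (c a b : ℝ) : Fin 8 → ℝ := ![0, 0, c + a, b, c - a, -b, 0, 1 + 2 * c]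

/-- `M⁴₄(c; T)` -/
def M44 (c a b : ℝ) : Fin 8 → ℝ := ![0, 0, 1 + a, b, 1 - a, -b, c, 2]

/-- `M⁴₅(c; T)` -/
def M45 (c a b : ℝ) : Fin 8 → ℝ := ![1, 0, a, b, -a, -b, 1 + c ^ 2, 2 * c]

/-- The models `M⁶ᵢ(T)`, `i = 0, …, 5`; they are flat and torsion free for `T = 0`. -/
def M6 (i : Fin 6) (a b : ℝ) : Fin 8 → ℝ :=
  ![M60 a b, M61 a b, M62 a b, M63 a b, M64 a b, M65 a b] i

/-! ## The model Lie algebras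

In each case the coordinates of a vector are taken with respect to the basis `e₁, e₂, …` in which
the Lie algebra is defined. -/

/-- The bracket of `KA` in coordinates. -/
def KA.br (_x _y : Fin 2 → ℝ) : Fin 2 → ℝ :=
  ![0, 0]

lemma KA.br_add_left (x y z : Fin 2 → ℝ) :
    KA.br (x + y) z = KA.br x z + KA.br y z := by
  ext m
  fin_cases m <;> simp [KA.br]

lemma KA.br_add_right (x y z : Fin 2 → ℝ) :
    KA.br x (y + z) = KA.br x y + KA.br x z := by
  ext m
  fin_cases m <;> simp [KA.br]

lemma KA.br_smul_right (c : ℝ) (x y : Fin 2 → ℝ) :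
    KA.br x (c • y) = c • KA.br x y := by
  ext m
  fin_cases m <;> simp [KA.br]

lemma KA.br_self (x : Fin 2 → ℝ) : KA.br x x = 0 := by
  ext m
  fin_cases m <;> simp [KA.br]

lemma KA.br_leibniz (x y z : Fin 2 → ℝ) :
    KA.br x (KA.br y z) = KA.br (KA.br x y) z + KA.br y (KA.br x z) := by
  ext m
  fin_cases m <;> simp [KA.br]

/-- The abelian Lie algebra `𝔎_A` with basis `e₁, e₂` and `[e₁, e₂] = 0`. -/
def KA : Type := Fin 2 → ℝ

instance : AddCommGroup KA := inferInstanceAs (AddCommGroup (Fin 2 → ℝ))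

instance : Module ℝ KA := inferInstanceAs (Module ℝ (Fin 2 → ℝ))

instance : LieRing KA where
  bracket x y := KA.br x y
  add_lie := KA.br_add_left
  lie_add := KA.br_add_right
  lie_self := KA.br_self
  leibniz_lie := KA.br_leibniz

instance : LieAlgebra ℝ KA where
  lie_smul := KA.br_smul_right

/-- The bracket of `KB` in coordinates. -/
def KB.br (x y : Fin 2 → ℝ) : Fin 2 → ℝ :=
  ![x 0 * y 1 - x 1 * y 0, 0]

lemma KB.br_add_left (x y z : Fin 2 → ℝ) :
    KB.br (x + y) z = KB.br x z + KB.br y z := by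
  ext m
  fin_cases m <;> simp [KB.br]
  ring

lemma KB.br_add_right (x y z : Fin 2 → ℝ) :
    KB.br x (y + z) = KB.br x y + KB.br x z := by
  ext m
  fin_cases m <;> simp [KB.br]
  ring

lemma KB.br_smul_right (c : ℝ) (x y : Fin 2 → ℝ) :
    KB.br x (c • y) = c • KB.br x y := by
  ext m
  fin_cases m <;> simp [KB.br]
  ring

lemma KB.br_self (x : Fin 2 → ℝ) : KB.br x x = 0 := by
  ext m
  fin_cases m <;> simp [KB.br]
  ring

lemma KB.br_leibniz (x y z : Fin 2 → ℝ) :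
    KB.br x (KB.br y z) = KB.br (KB.br x y) z + KB.br y (KB.br x z) := by
  ext m
  fin_cases m <;> simp [KB.br]
  ring

/-- The Lie algebra `𝔎_B` with basis `e₁, e₂` and `[e₁, e₂] = e₁`. -/
def KB : Type := Fin 2 → ℝ

instance : AddCommGroup KB := inferInstanceAs (AddCommGroup (Fin 2 → ℝ))

instance : Module ℝ KB := inferInstanceAs (Module ℝ (Fin 2 → ℝ))

instance : LieRing KB where
  bracket x y := KB.br x y
  add_lie := KB.br_add_left
  lie_add := KB.br_add_right
  lie_self := KB.br_self
  leibniz_lie := KB.br_leibniz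

instance : LieAlgebra ℝ KB where
  lie_smul := KB.br_smul_right

/-- The bracket of `A49` in coordinates. -/
def A49.br (x y : Fin 4 → ℝ) : Fin 4 → ℝ :=
  ![(x 1 * y 2 - x 2 * y 1) + (x 0 * y 3 - x 3 * y 0), x 1 * y 3 - x 3 * y 1, 0, 0]

lemma A49.br_add_left (x y z : Fin 4 → ℝ) :
    A49.br (x + y) z = A49.br x z + A49.br y z := by
  ext m
  fin_cases m <;> simp [A49.br] <;> ring

lemma A49.br_add_right (x y z : Fin 4 → ℝ) :
    A49.br x (y + z) = A49.br x y + A49.br x z := by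
  ext m
  fin_cases m <;> simp [A49.br] <;> ring

lemma A49.br_smul_right (c : ℝ) (x y : Fin 4 → ℝ) :
    A49.br x (c • y) = c • A49.br x y := by
  ext m
  fin_cases m <;> simp [A49.br] <;> ring

lemma A49.br_self (x : Fin 4 → ℝ) : A49.br x x = 0 := by
  ext m
  fin_cases m <;> simp [A49.br] <;> ring

lemma A49.br_leibniz (x y z : Fin 4 → ℝ) :
    A49.br x (A49.br y z) = A49.br (A49.br x y) z + A49.br y (A49.br x z) := by
  ext m
  fin_cases m <;> simp [A49.br] <;> ring

/-- The Lie algebra `A⁰_{4,9}` with basis `e₁, e₂, e₃, e₄` and the nonzero brackets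
`[e₂, e₃] = e₁`, `[e₁, e₄] = e₁`, `[e₂, e₄] = e₂`. -/
def A49 : Type := Fin 4 → ℝ

instance : AddCommGroup A49 := inferInstanceAs (AddCommGroup (Fin 4 → ℝ))

instance : Module ℝ A49 := inferInstanceAs (Module ℝ (Fin 4 → ℝ))

instance : LieRing A49 where
  bracket x y := A49.br x y
  add_lie := A49.br_add_left
  lie_add := A49.br_add_right
  lie_self := A49.br_self
  leibniz_lie := A49.br_leibniz

instance : LieAlgebra ℝ A49 where
  lie_smul := A49.br_smul_right

/-- The bracket of `A412` in coordinates. -/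
def A412.br (x y : Fin 4 → ℝ) : Fin 4 → ℝ :=
  ![(x 0 * y 2 - x 2 * y 0) + (x 1 * y 3 - x 3 * y 1), (x 1 * y 2 - x 2 * y 1) - (x 0 * y 3 - x 3 * y 0), 0, 0]

lemma A412.br_add_left (x y z : Fin 4 → ℝ) :
    A412.br (x + y) z = A412.br x z + A412.br y z := by
  ext m
  fin_cases m <;> simp [A412.br] <;> ring

lemma A412.br_add_right (x y z : Fin 4 → ℝ) :
    A412.br x (y + z) = A412.br x y + A412.br x z := by
  ext m
  fin_cases m <;> simp [A412.br] <;> ring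

lemma A412.br_smul_right (c : ℝ) (x y : Fin 4 → ℝ) :
    A412.br x (c • y) = c • A412.br x y := by
  ext m
  fin_cases m <;> simp [A412.br] <;> ring

lemma A412.br_self (x : Fin 4 → ℝ) : A412.br x x = 0 := by
  ext m
  fin_cases m <;> simp [A412.br] <;> ring

lemma A412.br_leibniz (x y z : Fin 4 → ℝ) :
    A412.br x (A412.br y z) = A412.br (A412.br x y) z + A412.br y (A412.br x z) := by
  ext m
  fin_cases m <;> simp [A412.br] <;> ring

/-- The Lie algebra `A_{4,12}` with basis `e₁, e₂, e₃, e₄` and the nonzero brackets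
`[e₁, e₃] = e₁`, `[e₂, e₃] = e₂`, `[e₁, e₄] = -e₂`, `[e₂, e₄] = e₁`. -/
def A412 : Type := Fin 4 → ℝ

instance : AddCommGroup A412 := inferInstanceAs (AddCommGroup (Fin 4 → ℝ))

instance : Module ℝ A412 := inferInstanceAs (Module ℝ (Fin 4 → ℝ))

instance : LieRing A412 where
  bracket x y := A412.br x y
  add_lie := A412.br_add_left
  lie_add := A412.br_add_right
  lie_self := A412.br_self
  leibniz_lie := A412.br_leibniz

instance : LieAlgebra ℝ A412 where
  lie_smul := A412.br_smul_right

/-- The Lie algebra `𝔸₆` of the affine group of the plane, realised as usual by the `3 × 3` matrices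
with vanishing last row, with the commutator bracket. -/
def A6 : LieSubalgebra ℝ (Matrix (Fin 3) (Fin 3) ℝ) where
  carrier := {m | ∀ j, m 2 j = 0}
  zero_mem' := by
    rw [Set.mem_ofPred_eq]
    intro j
    rfl
  add_mem' {m n} hm hn := by
    rw [Set.mem_ofPred_eq] at *
    intro j
    simp [hm j, hn j]
  smul_mem' c m hm := by
    rw [Set.mem_ofPred_eq] at *
    intro j
    simp [hm j]
  lie_mem' {m n} hm hn := by
    change ∀ j, (m * n - n * m) 2 j = 0
    change ∀ j, m 2 j = 0 at hm
    change ∀ j, n 2 j = 0 at hn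
    intro j
    simp [Matrix.mul_apply, hm, hn]

end

/-!
A Type A model is a bilinear product `x y = ∇_x y` on `ℝ²`, up to change of basis. The Killing
equations are linear and of second order with constant coefficients, so a Killing field is
determined by its one-jet at the origin (`killing_eq_zero_of_jet`), and linear changes of basis
pull Killing fields back to Killing fields (`LinEquivA.nonempty_lieEquiv`). Whether there are
Killing fields other than translations is controlled by two tensors that they preserve: the torsion
`T` (`torsion_killing`) and, if `T = 0`, the Ricci tensor (`ricci_killing`).

Suppose that some Killing field `v` is not a translation. If `T ≠ 0`, take `∂₁` in the direction of
`T`; invariance of `T` makes the second component of `v` constant. If `T = 0` and the Ricci tensor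
does not vanish, then it is degenerate: otherwise the derivative of `v` would be an infinitesimal
rotation and a derivation of the product, which a nonzero commutative product does not admit
(`ricci_degenerate`). Take `∂₁` in its kernel; again the second component of `v` is constant. In
both cases the Killing equations for that component make the line of `∂₁` a two-sided ideal for the
product and put the torsion on this line (`eq_idealModel_of_killing`), that is, the model is an
`idealModel`. For such a model the remaining Killing fields `f ∂₁` are governed by a linear
equation for `f` with constant coefficients along `∂₂`. Its discriminant and the action of `∂₁` on
the ideal lead to the listed normal forms (`idealModel_normalForm`), whose four-dimensional Killing
algebras are written down explicitly with exponentials, polynomials, sines and cosines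
(`idealModel_lieEquiv` and its applications).

If torsion and Ricci tensor both vanish, then the product is commutative and associative. It is
either zero or the ideal of `z` in `ℝ[z] / (z³ - d z² - c z)`, and the roots of `z² - d z - c` give
the six flat models (`classification_flat`). Each of them has globally defined flat coordinates `φ`,
`ψ`, and the Killing fields are the affine vector fields in these coordinates (`flat_lieEquiv`).

Finally, `T` and `∇_T T` are linearly independent for generic `ξ`, and then invariance of `T` and of
the connection forces the derivative of a Killing field to vanish (`eq_translations_of_generic`).
-/

noncomputable section

/-! ### The Killing equations of a Type A model -/

lemma pd_const (c : ℝ) (i : Fin 2) : pd i (fun _ => c) = fun _ => 0 := by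
  funext x
  simp [pd]

lemma isAffineKilling_modelA_iff {ξ : Fin 8 → ℝ} {v : Plane → Plane} :
    IsAffineKilling (modelA ξ) v ↔ ∀ i j k x,
      pd i (pd j (fun y => v y k)) x
        - ∑ l, christoffelA ξ i j l * pd l (fun y => v y k) x
        + ∑ l, christoffelA ξ i l k * pd j (fun y => v y l) x
        + ∑ l, christoffelA ξ l j k * pd i (fun y => v y l) x = 0 := by
  simp [IsAffineKilling, killingTensor, modelA, pd_const]

/-- The antisymmetric part of the Killing equations: an affine Killing field preserves the
torsion. -/
lemma torsion_killing {ξ : Fin 8 → ℝ} {v : Plane → Plane} (hv : ContDiff ℝ ∞ v)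
    (kv : IsAffineKilling (modelA ξ) v) (k : Fin 2) (x : Plane) :
    ∑ l, torsionA ξ l * pd l (fun y => v y k) x =
      torsionA ξ k * ∑ l, pd l (fun y => v y l) x := by
  have h := isAffineKilling_modelA_iff.1 kv
  have h1 := h 0 1 k x
  have h2 := h 1 0 k x
  rw [pd_comm (contDiff_component hv k) 1 0] at h2
  simp only [Fin.sum_univ_two, torsionA] at *
  linear_combination (-h1 + h2) / 2

lemma fderiv_eq_zero_of_pd {v : Plane → Plane} (hv : ContDiff ℝ ∞ v) {x : Plane}
    (h : ∀ i k, pd i (fun y => v y k) x = 0) : fderiv ℝ v x = 0 := by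
  ext a k
  rw [fderiv_apply_component hv]
  simp [h]

lemma const_of_pd {v : Plane → Plane} (hv : ContDiff ℝ ∞ v)
    (h : ∀ i k x, pd i (fun y => v y k) x = 0) (x y : Plane) : v x = v y :=
  is_const_of_fderiv_eq_zero (𝕜 := ℝ) (hv.differentiable (by simp))
    (fun x => fderiv_eq_zero_of_pd hv fun i k => h i k x) x y

lemma hasDerivAt_ray {f : Plane → ℝ} (hf : ContDiff ℝ ∞ f) (x : Plane) (s : ℝ) :
    HasDerivAt (fun t : ℝ => f (t • x)) (∑ i, x i * pd i f (s • x)) s := by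
  have h1 : HasFDerivAt f (fderiv ℝ f (s • x)) (s • x) :=
    ((hf.differentiable (by simp)).differentiableAt).hasFDerivAt
  have h2 : HasDerivAt (fun t : ℝ => t • x) ((1 : ℝ) • x) s := (hasDerivAt_id s).smul_const x
  have h3 := h1.comp_hasDerivAt s h2
  refine h3.congr_deriv ?_
  have : (1 : ℝ) • x = x 0 • (Pi.single 0 1 : Plane) + x 1 • (Pi.single 1 1 : Plane) := by
    ext m
    fin_cases m <;> simp
  rw [this, map_add, map_smul, map_smul, Fin.sum_univ_two]
  rfl

/-- The Killing equations express the second derivatives of `v` linearly through the first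
derivatives. This is the resulting system of linear ordinary differential equations for the first
derivatives along the ray in direction `x`. -/
def rayOperator (ξ : Fin 8 → ℝ) (x : Plane) :
    (Fin 2 → Fin 2 → ℝ) →ₗ[ℝ] (Fin 2 → Fin 2 → ℝ) where
  toFun A := fun j k => ∑ i, x i * (∑ l, christoffelA ξ i j l * A l k
    - ∑ l, christoffelA ξ i l k * A j l - ∑ l, christoffelA ξ l j k * A i l)
  map_add' A B := by
    ext j k
    simp only [Fin.sum_univ_two, Pi.add_apply]
    ring
  map_smul' c A := by
    ext j k
    simp only [Fin.sum_univ_two, Pi.smul_apply, smul_eq_mul, RingHom.id_apply]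
    ring

/-- An affine Killing field is determined by its one-jet at the origin. -/
theorem killing_eq_zero_of_jet {ξ : Fin 8 → ℝ} {v : Plane → Plane} (hv : ContDiff ℝ ∞ v)
    (kv : IsAffineKilling (modelA ξ) v) (h0 : v 0 = 0)
    (h1 : ∀ i k, pd i (fun y => v y k) 0 = 0) : v = 0 := by
  have hc := contDiff_component hv
  have key : ∀ x, ∀ j k, pd j (fun y => v y k) x = 0 := by
    intro x
    let f : ℝ → Fin 2 → Fin 2 → ℝ := fun t j k => pd j (fun y => v y k) (t • x)
    -- the ray `t ↦ t x` turns the Killing equations into a linear ODE with zero initial value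
    let L := LinearMap.toContinuousLinearMap (rayOperator ξ x)
    have hf : ∀ t, HasDerivAt f (L (f t)) t := by
      intro t
      rw [hasDerivAt_pi]
      intro j
      rw [hasDerivAt_pi]
      intro k
      refine (hasDerivAt_ray (contDiff_pd (hc k) j) x t).congr_deriv ?_
      have h := fun i => isAffineKilling_modelA_iff.1 kv i j k (t • x)
      simp only [L, LinearMap.coe_toContinuousLinearMap', rayOperator, LinearMap.coe_mk,
        AddHom.coe_mk, f, Fin.sum_univ_two] at h ⊢
      linear_combination x 0 * h 0 + x 1 * h 1
    have hz : ∀ t, HasDerivAt (0 : ℝ → Fin 2 → Fin 2 → ℝ)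
        (L ((0 : ℝ → Fin 2 → Fin 2 → ℝ) t)) t := by
      intro t
      simp
    have : f = 0 := by
      refine ODE_solution_unique_univ (v := fun _ => L) (s := fun _ => Set.univ) (t₀ := 0)
        (fun t => L.lipschitz.lipschitzOnWith) (fun t => ⟨hf t, trivial⟩)
        (fun t => ⟨hz t, trivial⟩) ?_
      ext j k
      simp [f, h1]
    intro j k
    simpa [f] using congrFun (congrFun (congrFun this 1) j) k
  funext x
  rw [const_of_pd hv (fun i k x => key x i k) x 0, h0]
  rfl

lemma coordField_mem (ξ : Fin 8 → ℝ) (i : Fin 2) : coordField i ∈ killingA ξ := by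
  change IsAffineKilling (modelA ξ) _
  rw [isAffineKilling_modelA_iff]
  simp [coordField, pd_const]

lemma translations_le (ξ : Fin 8 → ℝ) : translations ≤ (killingA ξ).toSubmodule := by
  rw [translations, Submodule.span_le]
  rintro _ (rfl | rfl) <;> exact coordField_mem ξ _

lemma mem_translations_iff {v : SmoothField} :
    v ∈ translations ↔ ∀ i k x, pd i (fun y => v.1 y k) x = 0 := by
  constructor
  · intro hv
    obtain ⟨a, b, rfl⟩ := Submodule.mem_span_pair.1 hv
    intro i k x
    exact congrFun (pd_const ((a • coordField 0 + b • coordField 1).1 0 k) i) x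
  · intro h
    refine Submodule.mem_span_pair.2 ⟨v.1 0 0, v.1 0 1, ?_⟩
    apply Subtype.ext
    funext x
    rw [const_of_pd v.contDiff h x 0]
    ext k
    fin_cases k <;> simp [coordField]

/-! ### Linear changes of coordinates -/

lemma GL_mul_inv_apply (P : GL (Fin 2) ℝ) (i j : Fin 2) :
    ∑ l, P.1 i l * P⁻¹.1 l j = if i = j then 1 else 0 := by
  rw [← Matrix.mul_apply, ← Units.val_mul, mul_inv_cancel, Units.val_one, Matrix.one_apply]

/-- The matrices of the left multiplications `y ↦ ∇_{∂_i} y`. -/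
def leftMul (ξ : Fin 8 → ℝ) (i : Fin 2) : Matrix (Fin 2) (Fin 2) ℝ :=
  Matrix.of fun k j => christoffelA ξ i j k

lemma leftMul_apply (ξ : Fin 8 → ℝ) (i j k : Fin 2) :
    leftMul ξ i k j = christoffelA ξ i j k := rfl

/-- Linear equivalence in terms of left multiplications. -/
lemma linEquivA_rel_iff {ξ η : Fin 8 → ℝ} {P : Matrix (Fin 2) (Fin 2) ℝ} :
    (∀ i j k : Fin 2, ∑ l, P k l * christoffelA ξ i j l =
      ∑ p, ∑ q, P p i * P q j * christoffelA η p q k) ↔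
    ∀ i, P * leftMul ξ i = (∑ p, P p i • leftMul η p) * P := by
  simp only [← Matrix.ext_iff, Fin.sum_univ_two, Matrix.mul_apply, Matrix.add_apply,
    Matrix.smul_apply, smul_eq_mul, leftMul_apply]
  refine forall_congr' fun i => ⟨fun h k j => ?_, fun h j k => ?_⟩
  · linear_combination h j k
  · linear_combination h k j

lemma linEquivA_iff {ξ η : Fin 8 → ℝ} : LinEquivA ξ η ↔
    ∃ P : GL (Fin 2) ℝ, ∀ i, P.1 * leftMul ξ i = (∑ p, P.1 p i • leftMul η p) * P.1 :=
  exists_congr fun _ => linEquivA_rel_iff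

lemma linEquivA_of_det_ne_zero {ξ η : Fin 8 → ℝ} (P : Matrix (Fin 2) (Fin 2) ℝ) (hP : P.det ≠ 0)
    (h : ∀ i, P * leftMul ξ i = (∑ p, P p i • leftMul η p) * P) : LinEquivA ξ η :=
  linEquivA_iff.2 ⟨Matrix.GeneralLinearGroup.mkOfDetNeZero P hP, h⟩

lemma linEquivA_rel_inv {ξ η : Fin 8 → ℝ} {P : GL (Fin 2) ℝ}
    (hP : ∀ i, P.1 * leftMul ξ i = (∑ p, P.1 p i • leftMul η p) * P.1) (i : Fin 2) :
    P⁻¹.1 * leftMul η i = (∑ p, P⁻¹.1 p i • leftMul ξ p) * P⁻¹.1 := by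
  have h1 : ∀ i, leftMul ξ i = P⁻¹.1 * (∑ p, P.1 p i • leftMul η p) * P.1 := fun i => by
    rw [Matrix.mul_assoc, ← hP, ← Matrix.mul_assoc, ← Units.val_mul, inv_mul_cancel,
      Units.val_one, Matrix.one_mul]
  have h2 : ∑ p, P⁻¹.1 p i • ∑ q, P.1 q p • leftMul η q = leftMul η i := by
    simp_rw [Finset.smul_sum, smul_smul]
    rw [Finset.sum_comm]
    have h3 : ∀ q, ∑ p, P⁻¹.1 p i * P.1 q p = if q = i then 1 else 0 := fun q => by
      rw [← GL_mul_inv_apply P q i]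
      exact Finset.sum_congr rfl fun p _ => mul_comm _ _
    simp_rw [← Finset.sum_smul, h3]
    simp
  have h4 : ∑ p, P⁻¹.1 p i • leftMul ξ p = P⁻¹.1 * leftMul η i * P.1 := by
    rw [← h2, Matrix.mul_sum, Matrix.sum_mul]
    refine Finset.sum_congr rfl fun p _ => ?_
    rw [h1, Matrix.mul_smul, Matrix.smul_mul]
  rw [h4, Matrix.mul_assoc, ← Units.val_mul, mul_inv_cancel, Units.val_one, Matrix.mul_one]

lemma LinEquivA.symm {ξ η : Fin 8 → ℝ} (h : LinEquivA ξ η) : LinEquivA η ξ := by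
  obtain ⟨P, hP⟩ := linEquivA_iff.1 h
  exact linEquivA_iff.2 ⟨P⁻¹, linEquivA_rel_inv hP⟩

lemma LinEquivA.trans {ξ η ζ : Fin 8 → ℝ} (h : LinEquivA ξ η) (h' : LinEquivA η ζ) :
    LinEquivA ξ ζ := by
  obtain ⟨P, hP⟩ := linEquivA_iff.1 h
  obtain ⟨Q, hQ⟩ := linEquivA_iff.1 h'
  refine linEquivA_iff.2 ⟨Q * P, fun i => ?_⟩
  rw [Units.val_mul, Matrix.mul_assoc, hP, ← Matrix.mul_assoc, Matrix.mul_sum]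
  simp_rw [Matrix.mul_smul, hQ, Matrix.mul_apply, ← Matrix.smul_mul, ← Matrix.sum_mul,
    Finset.smul_sum, smul_smul]
  rw [Finset.sum_comm, ← Matrix.mul_assoc]
  simp_rw [← Finset.sum_smul, mul_comm]

/-- Every basis, given by the columns of `Q`, can be used as a coordinate frame. -/
lemma exists_linEquivA (ξ : Fin 8 → ℝ) (Q : Matrix (Fin 2) (Fin 2) ℝ) (hQ : Q.det ≠ 0) :
    ∃ ξ' : Fin 8 → ℝ, LinEquivA ξ' ξ ∧
      ∀ i, Q * leftMul ξ' i = (∑ p, Q p i • leftMul ξ p) * Q := by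
  let N : Fin 2 → Matrix (Fin 2) (Fin 2) ℝ := fun i => Q⁻¹ * ((∑ p, Q p i • leftMul ξ p) * Q)
  let ξ' : Fin 8 → ℝ := ![N 0 0 0, N 0 1 0, N 0 0 1, N 0 1 1, N 1 0 0, N 1 1 0, N 1 0 1, N 1 1 1]
  have hN : ∀ i, leftMul ξ' i = N i := by
    intro i
    ext k j
    fin_cases i <;> fin_cases j <;> fin_cases k <;> simp [leftMul, christoffelA, ξ']
  have h : ∀ i, Q * leftMul ξ' i = (∑ p, Q p i • leftMul ξ p) * Q := by
    intro i
    rw [hN, ← Matrix.mul_assoc, Matrix.mul_nonsing_inv _ (isUnit_iff_ne_zero.2 hQ), Matrix.one_mul]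
  exact ⟨ξ', linEquivA_of_det_ne_zero Q hQ h, h⟩

/-! ### Pulling back vector fields along linear maps -/

lemma contDiff_mulVec (P : Matrix (Fin 2) (Fin 2) ℝ) {v : Plane → Plane} (hv : ContDiff ℝ ∞ v) :
    ContDiff ℝ ∞ (fun y => P.mulVec (v y)) :=
  (LinearMap.toContinuousLinearMap P.mulVecLin).contDiff.comp hv

lemma pd_comp_mulVec {f : Plane → ℝ} (hf : ContDiff ℝ ∞ f) (P : Matrix (Fin 2) (Fin 2) ℝ)
    (i : Fin 2) : pd i (fun y => f (P.mulVec y)) = fun y => ∑ l, P l i * pd l f (P.mulVec y) := by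
  funext x
  have h1 : HasFDerivAt f (fderiv ℝ f (P.mulVec x)) (P.mulVec x) :=
    ((hf.differentiable (by simp)).differentiableAt).hasFDerivAt
  have h2 := (LinearMap.toContinuousLinearMap P.mulVecLin).hasFDerivAt (x := x)
  have h3 : fderiv ℝ (fun y => f (P.mulVec y)) x = _ := (h1.comp x h2).fderiv
  have h4 : P.mulVec (Pi.single i 1) =
      P 0 i • (Pi.single 0 1 : Plane) + P 1 i • (Pi.single 1 1 : Plane) := by
    ext m
    fin_cases m <;> simp
  rw [pd, h3, Fin.sum_univ_two]
  simp only [ContinuousLinearMap.comp_apply, LinearMap.coe_toContinuousLinearMap',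
    Matrix.mulVecLin_apply, h4, map_add, map_smul, smul_eq_mul]
  rfl

/-- The vector field `P⁻¹ v(P y)`, the pullback of `v` along the linear map `P`. -/
def pullField (P : GL (Fin 2) ℝ) (v : SmoothField) : SmoothField :=
  ⟨fun y => P⁻¹.1.mulVec (v.1 (P.1.mulVec y)), mem_smoothFields.2
    (contDiff_mulVec _ (v.contDiff.comp (contDiff_mulVec _ contDiff_id)))⟩

lemma pullField_apply (P : GL (Fin 2) ℝ) (v : SmoothField) (y : Plane) :
    (pullField P v).1 y = P⁻¹.1.mulVec (v.1 (P.1.mulVec y)) := rfl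

lemma mulVec_pullField (P : GL (Fin 2) ℝ) (v : SmoothField) (y : Plane) :
    P.1.mulVec ((pullField P v).1 y) = v.1 (P.1.mulVec y) := by
  rw [pullField_apply, Matrix.mulVec_mulVec, ← Units.val_mul, mul_inv_cancel, Units.val_one,
    Matrix.one_mulVec]

lemma pullField_inv (P : GL (Fin 2) ℝ) (v : SmoothField) :
    pullField P⁻¹ (pullField P v) = v := by
  apply Subtype.ext
  funext y
  rw [pullField_apply, inv_inv, mulVec_pullField, Matrix.mulVec_mulVec, ← Units.val_mul,
    mul_inv_cancel, Units.val_one, Matrix.one_mulVec]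

lemma ext_of_mulVec (P : GL (Fin 2) ℝ) {a b : Plane} (h : ∀ k, ∑ l, P.1 k l * a l =
    ∑ l, P.1 k l * b l) : a = b := by
  have h1 : P.1.mulVec a = P.1.mulVec b := funext h
  have h2 := congrArg (P⁻¹.1.mulVec) h1
  simpa only [Matrix.mulVec_mulVec, ← Units.val_mul, inv_mul_cancel, Units.val_one,
    Matrix.one_mulVec] using h2

lemma mul_pullField (P : GL (Fin 2) ℝ) (v : SmoothField) (k : Fin 2) :
    (fun y => ∑ l, P.1 k l * (pullField P v).1 y l) = fun y => v.1 (P.1.mulVec y) k :=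
  funext fun y => congrFun (mulVec_pullField P v y) k

lemma mul_pd_pullField (P : GL (Fin 2) ℝ) (v : SmoothField) (i k : Fin 2) :
    (fun y => ∑ l, P.1 k l * pd i (fun z => (pullField P v).1 z l) y) =
      fun y => ∑ n, P.1 n i * pd n (fun z => v.1 z k) (P.1.mulVec y) := by
  have hc := contDiff_component (pullField P v).contDiff
  rw [← pd_comp_mulVec (contDiff_component v.contDiff k), ← mul_pullField]
  simp only [Fin.sum_univ_two]
  rw [pd_add (contDiff_const.mul (hc 0)) (contDiff_const.mul (hc 1)), pd_const_mul (hc 0),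
    pd_const_mul (hc 1)]

lemma mul_pd_pd_pullField (P : GL (Fin 2) ℝ) (v : SmoothField) (i j k : Fin 2) :
    (fun y => ∑ l, P.1 k l * pd i (pd j (fun z => (pullField P v).1 z l)) y) =
      fun y => ∑ n, P.1 n j * ∑ m, P.1 m i * pd m (pd n (fun z => v.1 z k)) (P.1.mulVec y) := by
  have hc := fun l => contDiff_pd (contDiff_component (pullField P v).contDiff l) j
  have hd := fun l => contDiff_pd (contDiff_component v.contDiff k) l
  have he : ∀ l, ContDiff ℝ ∞ (fun y => pd l (fun z => v.1 z k) (P.1.mulVec y)) :=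
    fun l => (hd l).comp (contDiff_mulVec P.1 contDiff_id)
  simp_rw [fun n y => (congrFun (pd_comp_mulVec (hd n) P.1 i) y).symm]
  have h := congrArg (pd i) (mul_pd_pullField P v j k)
  simp only [Fin.sum_univ_two] at h ⊢
  rw [pd_add (contDiff_const.mul (hc 0)) (contDiff_const.mul (hc 1)), pd_const_mul (hc 0),
    pd_const_mul (hc 1), pd_add (contDiff_const.mul (he 0)) (contDiff_const.mul (he 1)),
    pd_const_mul (he 0), pd_const_mul (he 1)] at h
  exact h

lemma pullField_lie (P : GL (Fin 2) ℝ) (v w : SmoothField) :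
    pullField P ⁅v, w⁆ = ⁅pullField P v, pullField P w⁆ := by
  apply Subtype.ext
  funext y
  refine ext_of_mulVec P fun k => ?_
  refine (congrFun (mulVec_pullField P ⁅v, w⁆ y) k).trans ?_
  have e1 := congrFun (lieBracket_component v.contDiff w.contDiff k) (P.1.mulVec y)
  have e2 := fun l => congrFun (lieBracket_component (pullField P v).contDiff
    (pullField P w).contDiff l) y
  have v1 := fun k => congrFun (mul_pullField P v k) y
  have w1 := fun k => congrFun (mul_pullField P w k) y
  have v2 := fun i => congrFun (mul_pd_pullField P v i k) y
  have w2 := fun i => congrFun (mul_pd_pullField P w i k) y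
  simp only [SmoothField.coe_bracket, e2]
  refine e1.trans ?_
  simp only [Fin.sum_univ_two] at v1 w1 v2 w2 ⊢
  rw [← v1, ← v1, ← w1, ← w1]
  linear_combination - (pullField P v).1 y 0 * w2 0 - (pullField P v).1 y 1 * w2 1
    + (pullField P w).1 y 0 * v2 0 + (pullField P w).1 y 1 * v2 1

lemma pullField_mem {ξ η : Fin 8 → ℝ} {P : GL (Fin 2) ℝ}
    (hP : ∀ i j k : Fin 2, ∑ l, P.1 k l * christoffelA ξ i j l =
      ∑ p, ∑ q, P.1 p i * P.1 q j * christoffelA η p q k) {v : SmoothField}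
    (hv : v ∈ killingA η) : pullField P v ∈ killingA ξ := by
  change IsAffineKilling _ _
  rw [isAffineKilling_modelA_iff]
  have hv : ∀ i j k x, _ := isAffineKilling_modelA_iff.1 hv
  intro i j k x
  have v2 := fun i k => congrFun (mul_pd_pullField P v i k) x
  have v3 := fun k => congrFun (mul_pd_pd_pullField P v i j k) x
  have hv := fun i j k => hv i j k (P.1.mulVec x)
  revert k
  refine congrFun (ext_of_mulVec P fun k => ?_)
  simp only [Fin.sum_univ_two] at hP hv v2 v3 ⊢
  linear_combination v3 k - christoffelA ξ i j 0 * v2 0 k - christoffelA ξ i j 1 * v2 1 k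
    - pd 0 (fun z => v.1 z k) (P.1.mulVec x) * hP i j 0
    - pd 1 (fun z => v.1 z k) (P.1.mulVec x) * hP i j 1
    + pd j (fun z => (pullField P v).1 z 0) x * hP i 0 k
    + pd j (fun z => (pullField P v).1 z 1) x * hP i 1 k
    + pd i (fun z => (pullField P v).1 z 0) x * hP 0 j k
    + pd i (fun z => (pullField P v).1 z 1) x * hP 1 j k
    + (P.1 0 i * christoffelA η 0 0 k + P.1 1 i * christoffelA η 1 0 k) * v2 j 0
    + (P.1 0 i * christoffelA η 0 1 k + P.1 1 i * christoffelA η 1 1 k) * v2 j 1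
    + (P.1 0 j * christoffelA η 0 0 k + P.1 1 j * christoffelA η 0 1 k) * v2 i 0
    + (P.1 0 j * christoffelA η 1 0 k + P.1 1 j * christoffelA η 1 1 k) * v2 i 1
    + P.1 0 i * P.1 0 j * hv 0 0 k + P.1 0 i * P.1 1 j * hv 0 1 k
    + P.1 1 i * P.1 0 j * hv 1 0 k + P.1 1 i * P.1 1 j * hv 1 1 k

/-- Linearly equivalent models have isomorphic algebras of affine Killing fields. -/
theorem LinEquivA.nonempty_lieEquiv {ξ η : Fin 8 → ℝ} (h : LinEquivA ξ η) :
    Nonempty (killingA ξ ≃ₗ⁅ℝ⁆ killingA η) := by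
  obtain ⟨P, hP⟩ := h
  have hsurj : ∀ w ∈ killingA ξ, pullField P⁻¹ w ∈ killingA η := fun w hw =>
    pullField_mem (linEquivA_rel_iff.2 (linEquivA_rel_inv (linEquivA_rel_iff.1 hP))) hw
  let f : killingA η →ₗ⁅ℝ⁆ killingA ξ :=
    { toFun := fun v => ⟨pullField P v.1, pullField_mem hP v.2⟩
      map_add' := fun v w => by
        apply Subtype.ext
        apply Subtype.ext
        funext y
        exact Matrix.mulVec_add P⁻¹.1 _ _
      map_smul' := fun c v => by
        apply Subtype.ext
        apply Subtype.ext
        funext y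
        exact Matrix.mulVec_smul P⁻¹.1 c _
      map_lie' := fun {v w} => Subtype.ext (pullField_lie P v.1 w.1) }
  have hf : Function.Bijective f := by
    refine ⟨fun v w hvw => ?_, fun w => ⟨⟨pullField P⁻¹ w.1, hsurj _ w.2⟩, ?_⟩⟩
    · have h1 : pullField P v.1 = pullField P w.1 := congrArg Subtype.val hvw
      have h2 := congrArg (pullField P⁻¹) h1
      rw [pullField_inv, pullField_inv] at h2
      exact Subtype.ext h2
    · apply Subtype.ext
      have := pullField_inv P⁻¹ w.1
      rwa [inv_inv] at this
  exact ⟨(LieEquiv.ofBijective f hf).symm⟩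

/-! ### Models whose Killing fields have constant second component -/

/-- The Type A models in which `∂₁` spans an ideal for the product `∇_x y`, with the torsion in the
direction of `∂₁`. -/
def idealModel (a c t n d : ℝ) : Fin 8 → ℝ := ![a, 0, c + t, 0, c - t, 0, n, d]

lemma idealModel_killing_iff {a c t n d : ℝ} {v : Plane → Plane} :
    IsAffineKilling (modelA (idealModel a c t n d)) v ↔ ∀ x,
      ((pd 0 (pd 0 (fun y => v y 1)) x = a * pd 0 (fun y => v y 1) x ∧
        pd 0 (pd 1 (fun y => v y 1)) x = (c + t - d) * pd 0 (fun y => v y 1) x) ∧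
       (pd 1 (pd 0 (fun y => v y 1)) x = (c - t - d) * pd 0 (fun y => v y 1) x ∧
        pd 1 (pd 1 (fun y => v y 1)) x =
          n * pd 0 (fun y => v y 1) x - d * pd 1 (fun y => v y 1) x)) ∧
      ((pd 0 (pd 0 (fun y => v y 0)) x =
          -a * pd 0 (fun y => v y 0) x - 2 * c * pd 0 (fun y => v y 1) x ∧
        pd 0 (pd 1 (fun y => v y 0)) x = -a * pd 1 (fun y => v y 0) x
          - (c + t) * pd 1 (fun y => v y 1) x - n * pd 0 (fun y => v y 1) x) ∧
       (pd 1 (pd 0 (fun y => v y 0)) x = -a * pd 1 (fun y => v y 0) x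
          - (c - t) * pd 1 (fun y => v y 1) x - n * pd 0 (fun y => v y 1) x ∧
        pd 1 (pd 1 (fun y => v y 0)) x = n * pd 0 (fun y => v y 0) x
          + (d - 2 * c) * pd 1 (fun y => v y 0) x - 2 * n * pd 1 (fun y => v y 1) x)) := by
  rw [isAffineKilling_modelA_iff]
  simp only [Fin.forall_fin_two, Fin.sum_univ_two, christoffelA, idealModel, Matrix.cons_val]
  constructor
  · rintro ⟨⟨⟨h1, h2⟩, h3, h4⟩, ⟨h5, h6⟩, h7, h8⟩ x
    refine ⟨⟨⟨?_, ?_⟩, ?_, ?_⟩, ⟨?_, ?_⟩, ?_, ?_⟩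
    · linear_combination h2 x
    · linear_combination h4 x
    · linear_combination h6 x
    · linear_combination h8 x
    · linear_combination h1 x
    · linear_combination h3 x
    · linear_combination h5 x
    · linear_combination h7 x
  · intro h
    refine ⟨⟨⟨fun x => ?_, fun x => ?_⟩, fun x => ?_, fun x => ?_⟩, ⟨fun x => ?_, fun x => ?_⟩,
      fun x => ?_, fun x => ?_⟩ <;> obtain ⟨⟨⟨h1, h2⟩, h3, h4⟩, ⟨h5, h6⟩, h7, h8⟩ := h x
    · linear_combination h5
    · linear_combination h1
    · linear_combination h6
    · linear_combination h2
    · linear_combination h7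
    · linear_combination h3
    · linear_combination h8
    · linear_combination h4

/-- If the torsion `t` does not vanish, or if it vanishes but the Ricci tensor does not, then the
second component of a Killing field of `idealModel` is constant. With torsion this follows from the
antisymmetric part of the Killing equations, without torsion from their integrability
conditions. -/
lemma idealModel_killing_const {a c t n d : ℝ} (hnd : t ≠ 0 ∨ n * a + c * (d - c) ≠ 0)
    {v : Plane → Plane} (hv : ContDiff ℝ ∞ v)
    (kv : IsAffineKilling (modelA (idealModel a c t n d)) v) (i : Fin 2) (x : Plane) :
    pd i (fun y => v y 1) x = 0 := by
  have hu := contDiff_component hv 0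
  have hw := contDiff_component hv 1
  have h := idealModel_killing_iff.1 kv
  rw [pd_comm hu 1 0, pd_comm hw 1 0] at h
  by_cases ht : t = 0
  · subst ht
    have hr : n * a + c * (d - c) ≠ 0 := hnd.resolve_left fun h => h rfl
    generalize (fun y => v y 0) = u at h hu
    generalize (fun y => v y 1) = w at h hw
    have hu0 := contDiff_pd hu 0
    have hu1 := contDiff_pd hu 1
    have hw0 := contDiff_pd hw 0
    have hw1 := contDiff_pd hw 1
    -- `∂₁∂₂∂₂ w` computed in two ways
    have w0 : pd 0 w = fun _ => 0 := by
      funext x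
      have e1 : pd 0 (pd 1 w) = fun y => (c - d) * pd 0 w y := by
        funext y
        linear_combination (h y).1.1.2
      have e2 : pd 1 (pd 1 w) = fun y => n * pd 0 w y - d * pd 1 w y :=
        funext fun y => (h y).1.2.2
      have e3 := congrFun (congrArg (pd 1) e1) x
      have e4 := congrFun (congrArg (pd 0) e2) x
      rw [pd_const_mul hw0, pd_comm hw 1 0, pd_comm hw1 1 0] at e3
      rw [pd_sub (contDiff_const.mul hw0) (contDiff_const.mul hw1), pd_const_mul hw0,
        pd_const_mul hw1] at e4
      obtain ⟨⟨⟨h1, h2⟩, h3, h4⟩, -⟩ := h x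
      refine (mul_eq_zero.1 ?_).resolve_left hr
      linear_combination e3 - e4 + (c - d) * h2 + d * h2 - n * h1
    -- `∂₁∂₂∂₂ u` computed in two ways
    have w1 : pd 1 w = fun _ => 0 := by
      funext x
      have e1 : pd 0 (pd 1 u) = fun y => -a * pd 1 u y - c * pd 1 w y := by
        funext y
        have := congrFun w0 y
        linear_combination (h y).2.1.2 - n * this
      have e2 : pd 1 (pd 1 u) = fun y => n * pd 0 u y + (d - 2 * c) * pd 1 u y
          - 2 * n * pd 1 w y := funext fun y => (h y).2.2.2
      have e3 := congrFun (congrArg (pd 1) e1) x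
      have e4 := congrFun (congrArg (pd 0) e2) x
      rw [pd_sub (contDiff_const.mul hu1) (contDiff_const.mul hw1), pd_const_mul hu1,
        pd_const_mul hw1, pd_comm hu1 1 0] at e3
      rw [pd_sub ((contDiff_const.mul hu0).add (contDiff_const.mul hu1)) (contDiff_const.mul hw1),
        pd_add (contDiff_const.mul hu0) (contDiff_const.mul hu1), pd_const_mul hu0,
        pd_const_mul hu1, pd_const_mul hw1] at e4
      have w00 := congrFun w0 x
      obtain ⟨⟨⟨h1, h2⟩, h3, h4⟩, ⟨h5, h6⟩, h7, h8⟩ := h x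
      refine (mul_eq_zero.1 ?_).resolve_left hr
      linear_combination (e4 - e3 + n * h5 + (d - 2 * c) * h6 - 2 * n * h2 + a * h8 + c * h4) / 2
        - n * (c - d) / 2 * w00
    revert i
    exact Fin.forall_fin_two.2 ⟨congrFun w0 x, congrFun w1 x⟩
  · obtain ⟨⟨⟨h1, h2⟩, h3, h4⟩, ⟨h5, h6⟩, h7, h8⟩ := h x
    revert i
    refine Fin.forall_fin_two.2 ⟨?_, ?_⟩
    · refine (mul_eq_zero.1 ?_).resolve_left ht
      linear_combination (h3 - h2) / 2
    · refine (mul_eq_zero.1 ?_).resolve_left ht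
      linear_combination (h6 - h7) / 2

/-- A Lie algebra whose elements are represented, in coordinates `κ`, by the fields
`f ∂₁ + s ∂₂` with `s` constant and `f` a solution of the Killing equations is isomorphic to the
Killing algebra, as soon as the fields represent every one-jet with constant second component. -/
theorem idealModel_lieEquiv {a c t n d : ℝ} (hnd : t ≠ 0 ∨ n * a + c * (d - c) ≠ 0)
    {L : Type*} [LieRing L] [LieAlgebra ℝ L] (κ : L ≃ₗ[ℝ] (Fin 4 → ℝ))
    (f f1 f2 : Fin 4 → Plane → ℝ) (s : Fin 4 → ℝ) (hf : ∀ i, ContDiff ℝ ∞ (f i))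
    (h1 : ∀ i, pd 0 (f i) = f1 i) (h2 : ∀ i, pd 1 (f i) = f2 i)
    (h11 : ∀ i, pd 0 (f1 i) = fun x => -a * f1 i x)
    (h12 : ∀ i, pd 0 (f2 i) = fun x => -a * f2 i x)
    (h22 : ∀ i, pd 1 (f2 i) = fun x => n * f1 i x + (d - 2 * c) * f2 i x)
    (hbr : ∀ (X Y : L) (x : Plane), ∑ i, κ ⁅X, Y⁆ i * f i x =
      ((∑ i, κ X i * f i x) * (∑ i, κ Y i * f1 i x) + (∑ i, κ X i * s i) * (∑ i, κ Y i * f2 i x))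
      - ((∑ i, κ Y i * f i x) * (∑ i, κ X i * f1 i x)
        + (∑ i, κ Y i * s i) * (∑ i, κ X i * f2 i x)))
    (hs : ∀ X Y : L, ∑ i, κ ⁅X, Y⁆ i * s i = 0)
    (hjet : ∀ J : Fin 4 → ℝ, ∃ X : Fin 4 → ℝ, ∑ i, X i * f i 0 = J 0 ∧ ∑ i, X i * s i = J 1 ∧
      ∑ i, X i * f1 i 0 = J 2 ∧ ∑ i, X i * f2 i 0 = J 3) :
    Nonempty (killingA (idealModel a c t n d) ≃ₗ⁅ℝ⁆ L) := by
  have hg : ∀ X : Fin 4 → ℝ, ContDiff ℝ ∞ (fun x => ∑ i, X i * f i x) := fun X =>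
    ContDiff.sum fun i _ => contDiff_const.mul (hf i)
  have hf1 : ∀ i, ContDiff ℝ ∞ (f1 i) := fun i => h1 i ▸ contDiff_pd (hf i) 0
  have hf2 : ∀ i, ContDiff ℝ ∞ (f2 i) := fun i => h2 i ▸ contDiff_pd (hf i) 1
  have pd_comb : ∀ (X : Fin 4 → ℝ) (g : Fin 4 → Plane → ℝ) (j : Fin 2),
      (∀ i, ContDiff ℝ ∞ (g i)) → pd j (fun x => ∑ i, X i * g i x) =
        fun x => ∑ i, X i * pd j (g i) x := by
    intro X g j hg
    have := fun i => (contDiff_const (c := X i)).mul (hg i)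
    simp only [Fin.sum_univ_four]
    simp (disch := fun_prop) only [pd_add, pd_const_mul]
  have c1 : ∀ X : Fin 4 → ℝ, pd 0 (fun x => ∑ i, X i * f i x) = fun x => ∑ i, X i * f1 i x :=
    fun X => by rw [pd_comb X f 0 hf]; simp only [h1]
  have c2 : ∀ X : Fin 4 → ℝ, pd 1 (fun x => ∑ i, X i * f i x) = fun x => ∑ i, X i * f2 i x :=
    fun X => by rw [pd_comb X f 1 hf]; simp only [h2]
  let F : L → SmoothField := fun X => ⟨fun x => ![∑ i, κ X i * f i x, ∑ i, κ X i * s i],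
    mem_smoothFields.2 (contDiff_pi.2 (Fin.forall_fin_two.2 ⟨hg _, contDiff_const⟩))⟩
  have F0 : ∀ X, (fun x => (F X).1 x 0) = fun x => ∑ i, κ X i * f i x := fun X => rfl
  have F1 : ∀ X, (fun x => (F X).1 x 1) = fun _ => ∑ i, κ X i * s i := fun X => rfl
  have hF : ∀ X, F X ∈ killingA (idealModel a c t n d) := by
    intro X
    refine idealModel_killing_iff.2 ?_
    rw [F0, F1, pd_comm (hg _) 1 0, c1, c2, pd_comb _ f1 _ hf1, pd_comb _ f2 _ hf2,
      pd_comb _ f2 _ hf2]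
    simp only [pd_const, h11, h12, h22, Fin.sum_univ_four]
    refine fun x => ⟨⟨⟨?_, ?_⟩, ?_, ?_⟩, ⟨?_, ?_⟩, ?_, ?_⟩ <;> ring
  let Φ : L →ₗ⁅ℝ⁆ killingA (idealModel a c t n d) :=
    { toFun := fun X => ⟨F X, hF X⟩
      map_add' := fun X Y => by
        apply Subtype.ext
        apply Subtype.ext
        funext x
        ext k
        fin_cases k
        · change ∑ i, κ (X + Y) i * f i x = ∑ i, κ X i * f i x + ∑ i, κ Y i * f i x
          simp only [map_add, Pi.add_apply, add_mul, Finset.sum_add_distrib]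
        · change ∑ i, κ (X + Y) i * s i = ∑ i, κ X i * s i + ∑ i, κ Y i * s i
          simp only [map_add, Pi.add_apply, add_mul, Finset.sum_add_distrib]
      map_smul' := fun r X => by
        apply Subtype.ext
        apply Subtype.ext
        funext x
        ext k
        fin_cases k
        · change ∑ i, κ (r • X) i * f i x = r * ∑ i, κ X i * f i x
          simp only [map_smul, Pi.smul_apply, smul_eq_mul, mul_assoc, Finset.mul_sum]
        · change ∑ i, κ (r • X) i * s i = r * ∑ i, κ X i * s i
          simp only [map_smul, Pi.smul_apply, smul_eq_mul, mul_assoc, Finset.mul_sum]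
      map_lie' := fun {X Y} => by
        apply Subtype.ext
        apply Subtype.ext
        funext x
        change (F ⁅X, Y⁆).1 x = (⁅F X, F Y⁆ : SmoothField).1 x
        rw [SmoothField.coe_bracket]
        ext k
        rw [congrFun (lieBracket_component (F X).contDiff (F Y).contDiff k) x]
        fin_cases k
        · change ∑ i, κ ⁅X, Y⁆ i * f i x =
            ((∑ i, κ X i * f i x) * pd 0 (fun x => ∑ i, κ Y i * f i x) x +
              (∑ i, κ X i * s i) * pd 1 (fun x => ∑ i, κ Y i * f i x) x) -
            ((∑ i, κ Y i * f i x) * pd 0 (fun x => ∑ i, κ X i * f i x) x +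
              (∑ i, κ Y i * s i) * pd 1 (fun x => ∑ i, κ X i * f i x) x)
          rw [hbr, c1, c2, c1, c2]
        · simp only [Fin.mk_one, Fin.isValue, F1, pd_const]
          simpa [F] using hs X Y }
  have hjet' : ∀ v : SmoothField, v ∈ killingA (idealModel a c t n d) → ∀ X,
      ∑ i, κ X i * f i 0 = v.1 0 0 → ∑ i, κ X i * s i = v.1 0 1 →
      ∑ i, κ X i * f1 i 0 = pd 0 (fun y => v.1 y 0) 0 →
      ∑ i, κ X i * f2 i 0 = pd 1 (fun y => v.1 y 0) 0 → F X = v := by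
    intro v hv X e0 e1 e2 e3
    have hsub : F X - v ∈ killingA (idealModel a c t n d) := sub_mem (hF X) hv
    have := killing_eq_zero_of_jet (F X - v).contDiff hsub ?_ ?_
    · exact sub_eq_zero.1 (Subtype.ext this)
    · ext k
      fin_cases k
      · exact sub_eq_zero.2 e0
      · exact sub_eq_zero.2 e1
    · intro i k
      have hvc := contDiff_component v.contDiff
      have hFc := contDiff_component (F X).contDiff
      change pd i (fun y => (F X).1 y k - v.1 y k) 0 = 0
      rw [pd_sub (hFc k) (hvc k)]
      fin_cases k
      · simp only [Fin.zero_eta, F0]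
        fin_cases i
        · simpa [c1, sub_eq_zero] using e2
        · simpa [c2, sub_eq_zero] using e3
      · simp only [Fin.mk_one, F1, pd_const, idealModel_killing_const hnd v.contDiff hv, sub_zero]
  let M : (Fin 4 → ℝ) →ₗ[ℝ] (Fin 4 → ℝ) := Matrix.mulVecLin
    (Matrix.of ![fun i => f i 0, s, fun i => f1 i 0, fun i => f2 i 0])
  have hM : ∀ X, M X = ![∑ i, X i * f i 0, ∑ i, X i * s i, ∑ i, X i * f1 i 0,
      ∑ i, X i * f2 i 0] := by
    intro X
    ext j
    fin_cases j <;> simp [M, Matrix.mulVec, dotProduct, mul_comm]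
  have hMs : Function.Surjective M := by
    intro J
    obtain ⟨X, e0, e1, e2, e3⟩ := hjet J
    refine ⟨X, ?_⟩
    rw [hM]
    ext j
    fin_cases j <;> assumption
  have hMi : Function.Injective M := LinearMap.injective_iff_surjective.2 hMs
  have hΦ : Function.Bijective Φ := by
    constructor
    · rw [injective_iff_map_eq_zero]
      intro X hX
      have hX' : F X = 0 := congrArg Subtype.val hX
      have a0 : (fun x => ∑ i, κ X i * f i x) = fun _ => 0 := by
        rw [← F0, hX']
        rfl
      have a1 : ∑ i, κ X i * s i = 0 := by
        have := congrFun (F1 X) 0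
        rw [hX'] at this
        exact this.symm
      have a2 := congrFun (c1 (κ X)) 0
      have a3 := congrFun (c2 (κ X)) 0
      rw [a0, pd_zero] at a2 a3
      have : M (κ X) = M 0 := by
        rw [map_zero, hM]
        ext j
        fin_cases j
        exacts [congrFun a0 0, a1, a2.symm, a3.symm]
      exact κ.map_eq_zero_iff.1 (hMi this)
    · rintro ⟨v, hv⟩
      obtain ⟨X, e0, e1, e2, e3⟩ := hjet ![v.1 0 0, v.1 0 1, pd 0 (fun y => v.1 y 0) 0,
        pd 1 (fun y => v.1 y 0) 0]
      refine ⟨κ.symm X, Subtype.ext (hjet' v hv _ ?_ ?_ ?_ ?_)⟩ <;>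
        simp only [LinearEquiv.apply_symm_apply] <;> assumption
  exact ⟨(LieEquiv.ofBijective Φ hΦ).symm⟩

/-! ### The four-dimensional Killing algebras -/

lemma contDiff_coord (k : Fin 2) : ContDiff ℝ ∞ (fun y : Plane => y k) := contDiff_apply ℝ ℝ k

lemma pd_coord (i k : Fin 2) : pd i (fun y => y k) = fun _ => if k = i then 1 else 0 := by
  funext x
  have : HasFDerivAt (fun y : Plane => y k) (ContinuousLinearMap.proj (R := ℝ) k) x :=
    (ContinuousLinearMap.proj (R := ℝ) (φ := fun _ : Fin 2 => ℝ) k).hasFDerivAt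
  rw [pd, this.fderiv]
  simp [Pi.single_apply]

lemma pd_exp {f : Plane → ℝ} (hf : ContDiff ℝ ∞ f) (i : Fin 2) :
    pd i (fun y => Real.exp (f y)) = fun y => Real.exp (f y) * pd i f y := by
  funext x
  have h1 := (hf.differentiable (by simp)).differentiableAt (x := x)
  simp [pd, fderiv_exp h1]

lemma pd_cos {f : Plane → ℝ} (hf : ContDiff ℝ ∞ f) (i : Fin 2) :
    pd i (fun y => Real.cos (f y)) = fun y => -Real.sin (f y) * pd i f y := by
  funext x
  have h1 := (hf.differentiable (by simp)).differentiableAt (x := x)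
  simp [pd, fderiv_cos h1]

lemma pd_sin {f : Plane → ℝ} (hf : ContDiff ℝ ∞ f) (i : Fin 2) :
    pd i (fun y => Real.sin (f y)) = fun y => Real.cos (f y) * pd i f y := by
  funext x
  have h1 := (hf.differentiable (by simp)).differentiableAt (x := x)
  simp [pd, fderiv_sin h1]

lemma pd_neg (f : Plane → ℝ) (i : Fin 2) :
    pd i (fun y => -f y) = fun y => -pd i f y := by
  funext x
  simp [pd]

/-- The coordinates of `𝔎_B ⊕ 𝔎_B` with respect to the bases of the two summands. -/
def coordsKBKB : (KB × KB) ≃ₗ[ℝ] (Fin 4 → ℝ) where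
  toFun X := ![X.1 0, X.1 1, X.2 0, X.2 1]
  invFun x := (![x 0, x 1], ![x 2, x 3])
  map_add' X Y := by
    ext i
    fin_cases i <;> rfl
  map_smul' r X := by
    ext i
    fin_cases i <;> rfl
  left_inv X := by
    refine Prod.ext ?_ ?_ <;> funext i <;> fin_cases i <;> rfl
  right_inv x := by
    ext i
    fin_cases i <;> rfl

lemma coordsKBKB_lie (X Y : KB × KB) : coordsKBKB ⁅X, Y⁆ =
    ![coordsKBKB X 0 * coordsKBKB Y 1 - coordsKBKB X 1 * coordsKBKB Y 0, 0,
      coordsKBKB X 2 * coordsKBKB Y 3 - coordsKBKB X 3 * coordsKBKB Y 2, 0] := rfl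

/-- The coordinates of `A⁰_{4,9}`. -/
def coordsA49 : A49 ≃ₗ[ℝ] (Fin 4 → ℝ) := LinearEquiv.refl ℝ (Fin 4 → ℝ)

lemma coordsA49_lie (X Y : A49) : coordsA49 ⁅X, Y⁆ = A49.br (coordsA49 X) (coordsA49 Y) := rfl

/-- The coordinates of `A_{4,12}`. -/
def coordsA412 : A412 ≃ₗ[ℝ] (Fin 4 → ℝ) := LinearEquiv.refl ℝ (Fin 4 → ℝ)

lemma coordsA412_lie (X Y : A412) :
    coordsA412 ⁅X, Y⁆ = A412.br (coordsA412 X) (coordsA412 Y) := rfl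

/-- The Killing algebra is spanned by `∂₁`, `x¹ ∂₁ + ∂₂` and `exp(x²) ∂₁`, `-∂₂`. -/
lemma idealModel_zero_KBKB {c t : ℝ} (hnd : t ≠ 0 ∨ c * (1 + c) ≠ 0) :
    Nonempty (killingA (idealModel 0 c t 0 (1 + 2 * c)) ≃ₗ⁅ℝ⁆ KB × KB) := by
  have e := contDiff_coord
  refine idealModel_lieEquiv (hnd.imp_right fun h h' => h (by linarith)) coordsKBKB
    ![fun _ => 1, fun x => x 0, fun x => Real.exp (x 1), fun _ => 0]
    ![fun _ => 0, fun _ => 1, fun _ => 0, fun _ => 0]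
    ![fun _ => 0, fun _ => 0, fun x => Real.exp (x 1), fun _ => 0]
    ![0, 1, 0, -1] ?_ ?_ ?_ ?_ ?_ ?_ ?_ ?_ ?_
  · intro i
    fin_cases i <;> simp <;> fun_prop
  iterate 5
    refine Fin.forall_fin_succ.2 ⟨?_, Fin.forall_fin_succ.2 ⟨?_, Fin.forall_fin_two.2 ⟨?_, ?_⟩⟩⟩ <;>
      simp (disch := fun_prop) [pd_const, pd_coord, pd_exp]
  · intro X Y x
    rw [coordsKBKB_lie]
    simp [Fin.sum_univ_four]
    ring
  · intro X Y
    rw [coordsKBKB_lie]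
    simp [Fin.sum_univ_four]
  · intro J
    refine ⟨![J 0 - J 3, J 2, J 3, J 2 - J 1], ?_⟩
    simp [Fin.sum_univ_four]

/-- The Killing algebra is spanned by `exp(x¹) ∂₁`, `∂₂ - ∂₁` and `exp(x¹ + x²) ∂₁`, `-∂₂`. -/
lemma idealModel_neg_one_KBKB {c t : ℝ} (hnd : t ≠ 0 ∨ c * (1 + c) ≠ 0) :
    Nonempty (killingA (idealModel (-1) c t 0 (1 + 2 * c)) ≃ₗ⁅ℝ⁆ KB × KB) := by
  have e := contDiff_coord
  refine idealModel_lieEquiv (hnd.imp_right fun h h' => h (by linarith)) coordsKBKB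
    ![fun x => Real.exp (x 0), fun _ => -1, fun x => Real.exp (x 0 + x 1), fun _ => 0]
    ![fun x => Real.exp (x 0), fun _ => 0, fun x => Real.exp (x 0 + x 1), fun _ => 0]
    ![fun _ => 0, fun _ => 0, fun x => Real.exp (x 0 + x 1), fun _ => 0]
    ![0, 1, 0, -1] ?_ ?_ ?_ ?_ ?_ ?_ ?_ ?_ ?_
  · intro i
    fin_cases i <;> simp <;> fun_prop
  iterate 5
    refine Fin.forall_fin_succ.2 ⟨?_, Fin.forall_fin_succ.2 ⟨?_, Fin.forall_fin_two.2 ⟨?_, ?_⟩⟩⟩ <;>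
      simp (disch := fun_prop) [pd_const, pd_coord, pd_exp, pd_add]
  · intro X Y x
    rw [coordsKBKB_lie]
    simp [Fin.sum_univ_four]
    ring
  · intro X Y
    rw [coordsKBKB_lie]
    simp [Fin.sum_univ_four]
  · intro J
    refine ⟨![J 2 - J 3, J 2 - J 0, J 3, J 2 - J 0 - J 1], ?_⟩
    simp [Fin.sum_univ_four]

/-- The Killing algebra is spanned by `exp(x¹) ∂₁`, `x² exp(x¹) ∂₁`, `-∂₂`, `-∂₁`. -/
lemma idealModel_neg_one_A49 {c t : ℝ} (hnd : t ≠ 0 ∨ c ≠ 0) :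
    Nonempty (killingA (idealModel (-1) c t 0 (2 * c)) ≃ₗ⁅ℝ⁆ A49) := by
  have e := contDiff_coord
  refine idealModel_lieEquiv
    (hnd.imp_right fun h h' => h (pow_eq_zero_iff two_ne_zero |>.1 (by linarith))) coordsA49
    ![fun x => Real.exp (x 0), fun x => x 1 * Real.exp (x 0), fun _ => 0, fun _ => -1]
    ![fun x => Real.exp (x 0), fun x => x 1 * Real.exp (x 0), fun _ => 0, fun _ => 0]
    ![fun _ => 0, fun x => Real.exp (x 0), fun _ => 0, fun _ => 0]
    ![0, 0, -1, 0] ?_ ?_ ?_ ?_ ?_ ?_ ?_ ?_ ?_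
  · intro i
    fin_cases i <;> simp <;> fun_prop
  iterate 5
    refine Fin.forall_fin_succ.2 ⟨?_, Fin.forall_fin_succ.2 ⟨?_, Fin.forall_fin_two.2 ⟨?_, ?_⟩⟩⟩ <;>
      simp (disch := fun_prop) [pd_const, pd_coord, pd_exp, pd_mul]
  · intro X Y x
    rw [coordsA49_lie, A49.br]
    simp [Fin.sum_univ_four]
    ring
  · intro X Y
    rw [coordsA49_lie, A49.br]
    simp [Fin.sum_univ_four]
  · intro J
    refine ⟨![J 2, J 3, -J 1, J 2 - J 0], ?_⟩
    simp [Fin.sum_univ_four]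

/-- The Killing algebra is spanned by `∂₁`, `x² ∂₁`, `n x² ∂₁ - ∂₂`, `(x¹ + n (x²)² / 2) ∂₁`. -/
lemma idealModel_zero_A49 {c t n : ℝ} (hnd : t ≠ 0 ∨ c ≠ 0) :
    Nonempty (killingA (idealModel 0 c t n (2 * c)) ≃ₗ⁅ℝ⁆ A49) := by
  have e := contDiff_coord
  refine idealModel_lieEquiv
    (hnd.imp_right fun h h' => h (pow_eq_zero_iff two_ne_zero |>.1 (by linarith))) coordsA49
    ![fun _ => 1, fun x => x 1, fun x => n * x 1, fun x => x 0 + n / 2 * (x 1 * x 1)]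
    ![fun _ => 0, fun _ => 0, fun _ => 0, fun _ => 1]
    ![fun _ => 0, fun _ => 1, fun _ => n, fun x => n * x 1]
    ![0, 0, -1, 0] ?_ ?_ ?_ ?_ ?_ ?_ ?_ ?_ ?_
  · intro i
    fin_cases i <;> simp <;> fun_prop
  iterate 5
    refine Fin.forall_fin_succ.2 ⟨?_, Fin.forall_fin_succ.2 ⟨?_, Fin.forall_fin_two.2 ⟨?_, ?_⟩⟩⟩ <;>
      simp (disch := fun_prop) [pd_const, pd_coord, pd_add, pd_mul] <;>
      (try (funext x; ring))
  · intro X Y x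
    rw [coordsA49_lie, A49.br]
    simp [Fin.sum_univ_four]
    ring
  · intro X Y
    rw [coordsA49_lie, A49.br]
    simp [Fin.sum_univ_four]
  · intro J
    refine ⟨![J 0, J 3 + n * J 1, -J 1, J 2], ?_⟩
    simp [Fin.sum_univ_four]
    ring

/-- The Killing algebra is spanned by `exp(-x¹ + c x²) cos(x²) ∂₁`, `exp(-x¹ + c x²) sin(x²) ∂₁`,
`∂₁` and `-(∂₂ + c ∂₁)`. -/
lemma idealModel_A412 {c t : ℝ} :
    Nonempty (killingA (idealModel 1 0 t (1 + c ^ 2) (2 * c)) ≃ₗ⁅ℝ⁆ A412) := by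
  have e := contDiff_coord
  refine idealModel_lieEquiv (Or.inr fun h => by nlinarith [sq_nonneg c]) coordsA412
    ![fun x => Real.exp (c * x 1 - x 0) * Real.cos (x 1),
      fun x => Real.exp (c * x 1 - x 0) * Real.sin (x 1), fun _ => 1, fun _ => -c]
    ![fun x => -(Real.exp (c * x 1 - x 0) * Real.cos (x 1)),
      fun x => -(Real.exp (c * x 1 - x 0) * Real.sin (x 1)), fun _ => 0, fun _ => 0]
    ![fun x => c * (Real.exp (c * x 1 - x 0) * Real.cos (x 1))
        - Real.exp (c * x 1 - x 0) * Real.sin (x 1),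
      fun x => c * (Real.exp (c * x 1 - x 0) * Real.sin (x 1))
        + Real.exp (c * x 1 - x 0) * Real.cos (x 1), fun _ => 0, fun _ => 0]
    ![0, 0, 0, -1] ?_ ?_ ?_ ?_ ?_ ?_ ?_ ?_ ?_
  · intro i
    fin_cases i <;> simp <;> fun_prop
  iterate 5
    refine Fin.forall_fin_succ.2 ⟨?_, Fin.forall_fin_succ.2 ⟨?_, Fin.forall_fin_two.2 ⟨?_, ?_⟩⟩⟩ <;>
      simp (disch := fun_prop) [pd_const, pd_coord, pd_exp, pd_add, pd_sub,
        pd_mul, pd_neg, pd_cos, pd_sin]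
      <;> (try (funext x; ring))
  · intro X Y x
    rw [coordsA412_lie, A412.br]
    simp [Fin.sum_univ_four]
    ring
  · intro X Y
    rw [coordsA412_lie, A412.br]
    simp [Fin.sum_univ_four]
  · intro J
    refine ⟨![-J 2, J 3 + c * J 2, J 0 + J 2 - c * J 1, -J 1], ?_⟩
    simp [Fin.sum_univ_four]
    constructor <;> ring

/-! ### Flat torsion free models -/

/-- The one-jet at the origin of an affine Killing field. -/
def jetMap (ξ : Fin 8 → ℝ) : killingA ξ →ₗ[ℝ] Plane × (Fin 2 → Fin 2 → ℝ) where
  toFun v := (v.1.1 0, fun i k => pd i (fun y => v.1.1 y k) 0)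
  map_add' v w := by
    refine Prod.ext rfl ?_
    funext i k
    exact congrFun (pd_add (contDiff_component v.1.contDiff k)
      (contDiff_component w.1.contDiff k) i) 0
  map_smul' r v := by
    refine Prod.ext rfl ?_
    funext i k
    exact congrFun (pd_const_mul (contDiff_component v.1.contDiff k) r i) 0

lemma jetMap_injective (ξ : Fin 8 → ℝ) : Function.Injective (jetMap ξ) := by
  rw [injective_iff_map_eq_zero]
  intro v hv
  exact Subtype.ext (Subtype.ext (killing_eq_zero_of_jet v.1.contDiff v.2
    (congrArg Prod.fst hv) fun i k => congrFun (congrFun (congrArg Prod.snd hv) i) k))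

instance (ξ : Fin 8 → ℝ) : FiniteDimensional ℝ (killingA ξ) :=
  FiniteDimensional.of_injective (jetMap ξ) (jetMap_injective ξ)

lemma finrank_killingA_le (ξ : Fin 8 → ℝ) : Module.finrank ℝ (killingA ξ) ≤ 6 := by
  have := LinearMap.finrank_le_finrank_of_injective (jetMap_injective ξ)
  simpa [Module.finrank_pi_fintype, Module.finrank_prod] using this

/-- The derivative of the function `f` along the vector field `v`. -/
def dirDeriv (v : Plane → Plane) (f : Plane → ℝ) (x : Plane) : ℝ :=
  v x 0 * pd 0 f x + v x 1 * pd 1 f x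

lemma eq_of_mul_jacobian {p q r s a b c d : ℝ} (h : p * s - r * q ≠ 0)
    (h1 : a * p + b * r = c * p + d * r) (h2 : a * q + b * s = c * q + d * s) : a = c ∧ b = d := by
  constructor <;> refine sub_eq_zero.1 ((mul_eq_zero.1 ?_).resolve_left h)
  · linear_combination s * h1 - r * h2
  · linear_combination p * h2 - q * h1

lemma dirDeriv_lieBracket (v w : SmoothField) {f : Plane → ℝ} (hf : ContDiff ℝ ∞ f) (x : Plane) :
    dirDeriv (⁅v, w⁆ : SmoothField).1 f x =
      dirDeriv v.1 (dirDeriv w.1 f) x - dirDeriv w.1 (dirDeriv v.1 f) x := by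
  have hv := contDiff_component v.contDiff
  have hw := contDiff_component w.contDiff
  have hf1 := contDiff_pd hf
  have e := fun k => congrFun (lieBracket_component v.contDiff w.contDiff k) x
  have key : ∀ u : SmoothField, ∀ i, pd i (dirDeriv u.1 f) x =
      (u.1 x 0 * pd i (pd 0 f) x + pd 0 f x * pd i (fun y => u.1 y 0) x)
      + (u.1 x 1 * pd i (pd 1 f) x + pd 1 f x * pd i (fun y => u.1 y 1) x) := by
    intro u i
    have hu := contDiff_component u.contDiff
    change pd i (fun y => u.1 y 0 * pd 0 f y + u.1 y 1 * pd 1 f y) x = _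
    simp (disch := fun_prop) only [pd_add, pd_mul]
  rw [dirDeriv, SmoothField.coe_bracket, e, e]
  rw [dirDeriv, key, key, dirDeriv, key, key, pd_comm hf 1 0]
  ring

section AffineFunctions

variable {ξ : Fin 8 → ℝ} {φ ψ : Plane → ℝ}

/-- The function `f` is affine with respect to the connection: its covariant Hessian vanishes. -/
def IsAffineFunction (ξ : Fin 8 → ℝ) (f : Plane → ℝ) : Prop :=
  ∀ i j x, pd i (pd j f) x = ∑ l, christoffelA ξ i j l * pd l f x

/-- If `v f` is affine, for an affine function `f`, then the Lie derivative of the connection along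
`v` annihilates `df`. -/
lemma killing_of_dirDeriv_affine (v : SmoothField) {f : Plane → ℝ} (hf : ContDiff ℝ ∞ f)
    (af : IsAffineFunction ξ f) (avf : IsAffineFunction ξ (dirDeriv v.1 f)) (i j : Fin 2)
    (x : Plane) :
    killingTensor (modelA ξ) v.1 i j 0 x * pd 0 f x
      + killingTensor (modelA ξ) v.1 i j 1 x * pd 1 f x = 0 := by
  have hv := contDiff_component v.contDiff
  have hv1 := fun k i => contDiff_pd (hv k) i
  have hf1 := contDiff_pd hf
  have hf2 := fun i j => contDiff_pd (hf1 i) j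
  have e1 : ∀ i, pd i (dirDeriv v.1 f) = fun y =>
      (v.1 y 0 * pd i (pd 0 f) y + pd 0 f y * pd i (fun y => v.1 y 0) y)
      + (v.1 y 1 * pd i (pd 1 f) y + pd 1 f y * pd i (fun y => v.1 y 1) y) := by
    intro i
    change pd i (fun y => v.1 y 0 * pd 0 f y + v.1 y 1 * pd 1 f y) = _
    simp (disch := fun_prop) only [pd_add, pd_mul]
  have e2 := congrFun (congrArg (pd i) (e1 j)) x
  simp (disch := fun_prop) only [pd_add, pd_mul] at e2
  have e3 := avf i j x
  have e4 : ∀ l, pd i (pd j (pd l f)) x = christoffelA ξ i j 0 * pd l (pd 0 f) x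
      + christoffelA ξ i j 1 * pd l (pd 1 f) x := by
    intro l
    have : pd i (pd j f) = fun y => christoffelA ξ i j 0 * pd 0 f y
        + christoffelA ξ i j 1 * pd 1 f y := by
      funext y
      rw [af i j y, Fin.sum_univ_two]
    rw [pd_comm hf j l, pd_comm (hf1 j) i l, this]
    simp (disch := fun_prop) only [pd_add, pd_const_mul]
  rw [e2, e4, e4, pd_comm hf j 0, pd_comm hf j 1] at e3
  simp only [e1, Fin.sum_univ_two] at e3
  have a := fun i j => af i j x
  simp only [Fin.sum_univ_two] at a
  simp only [killingTensor, modelA, pd_const, Fin.sum_univ_two]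
  linear_combination e3 - pd j (fun y => v.1 y 0) x * a i 0 - pd j (fun y => v.1 y 1) x * a i 1
    - pd i (fun y => v.1 y 0) x * a 0 j - pd i (fun y => v.1 y 1) x * a 1 j
    + (v.1 x 1 * christoffelA ξ i j 0 - v.1 x 0 * christoffelA ξ i j 1)
      * congrFun (pd_comm hf 0 1) x

/-- Two affine functions `φ`, `ψ` with nowhere vanishing Jacobian are flat coordinates. The Killing
fields are the fields `v` such that `v φ` and `v ψ` are affine combinations of `φ`, `ψ` and `1`. -/
theorem flat_lieEquiv (hφ : ContDiff ℝ ∞ φ) (hψ : ContDiff ℝ ∞ ψ) (aφ : IsAffineFunction ξ φ)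
    (aψ : IsAffineFunction ξ ψ) (hJ : ∀ x, pd 0 φ x * pd 1 ψ x - pd 1 φ x * pd 0 ψ x ≠ 0) :
    Nonempty (killingA ξ ≃ₗ⁅ℝ⁆ A6) := by
  have hφ1 := contDiff_pd hφ
  have hψ1 := contDiff_pd hψ
  -- the sign turns the anti-homomorphism from affine maps to vector fields into a homomorphism
  let w : Fin 3 → Matrix (Fin 3) (Fin 3) ℝ → Plane → ℝ := fun a m x =>
    -(m a 0 * φ x + m a 1 * ψ x + m a 2)
  have hw : ∀ a m, ContDiff ℝ ∞ (w a m) := by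
    intro a m
    simp only [w]
    fun_prop
  have w1 : ∀ a m i, pd i (w a m) = fun x => -(m a 0 * pd i φ x + m a 1 * pd i ψ x) := by
    intro a m i
    simp only [w]
    simp (disch := fun_prop) only [pd_neg, pd_add, pd_const_mul, pd_const, add_zero]
  have aw : ∀ a m, IsAffineFunction ξ (w a m) := by
    intro a m i j x
    simp only [w1, Fin.sum_univ_two]
    have h1 := aφ i j x
    have h2 := aψ i j x
    simp only [Fin.sum_univ_two] at h1 h2
    simp (disch := fun_prop) only [pd_neg, pd_add, pd_const_mul]
    linear_combination -m a 0 * h1 - m a 1 * h2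
  let F : Matrix (Fin 3) (Fin 3) ℝ → SmoothField := fun m => ⟨fun x =>
    ![(w 0 m x * pd 1 ψ x - w 1 m x * pd 1 φ x) / (pd 0 φ x * pd 1 ψ x - pd 1 φ x * pd 0 ψ x),
      (w 1 m x * pd 0 φ x - w 0 m x * pd 0 ψ x) / (pd 0 φ x * pd 1 ψ x - pd 1 φ x * pd 0 ψ x)],
    mem_smoothFields.2 (contDiff_pi.2 (Fin.forall_fin_two.2
      ⟨ContDiff.div (by fun_prop) (by fun_prop) hJ, ContDiff.div (by fun_prop) (by fun_prop) hJ⟩))⟩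
  have F0 : ∀ m, dirDeriv (F m).1 φ = w 0 m := by
    intro m
    funext x
    have := hJ x
    simp only [dirDeriv, F, Matrix.cons_val]
    rw [div_mul_eq_mul_div, div_mul_eq_mul_div, ← add_div, div_eq_iff this]
    ring
  have F1 : ∀ m, dirDeriv (F m).1 ψ = w 1 m := by
    intro m
    funext x
    have := hJ x
    simp only [dirDeriv, F, Matrix.cons_val]
    rw [div_mul_eq_mul_div, div_mul_eq_mul_div, ← add_div, div_eq_iff this]
    ring
  have huniq : ∀ v v' : SmoothField, dirDeriv v.1 φ = dirDeriv v'.1 φ →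
      dirDeriv v.1 ψ = dirDeriv v'.1 ψ → v = v' := by
    intro v v' h1 h2
    apply Subtype.ext
    funext x
    have := eq_of_mul_jacobian (hJ x) (congrFun h1 x) (congrFun h2 x)
    ext k
    fin_cases k
    exacts [this.1, this.2]
  have hF : ∀ m, F m ∈ killingA ξ := by
    intro m i j k x
    have h1 := killing_of_dirDeriv_affine (F m) hφ aφ (F0 m ▸ aw 0 m) i j x
    have h2 := killing_of_dirDeriv_affine (F m) hψ aψ (F1 m ▸ aw 1 m) i j x
    have := eq_of_mul_jacobian (c := 0) (d := 0) (hJ x) (by simpa using h1) (by simpa using h2)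
    revert k
    exact Fin.forall_fin_two.2 this
  have Fw : ∀ a m n x, dirDeriv (F m).1 (w a n) x = -(n a 0 * w 0 m x + n a 1 * w 1 m x) := by
    intro a m n x
    have h0 := congrFun (F0 m) x
    have h1 := congrFun (F1 m) x
    simp only [dirDeriv] at h0 h1
    rw [dirDeriv, w1, w1]
    linear_combination -n a 0 * h0 - n a 1 * h1
  have hadd : ∀ m n, F (m + n) = F m + F n := by
    intro m n
    apply Subtype.ext
    funext x
    ext k
    fin_cases k <;> simp [F, w] <;> ring
  have hsmul : ∀ (r : ℝ) m, F (r • m) = r • F m := by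
    intro r m
    apply Subtype.ext
    funext x
    ext k
    fin_cases k <;> simp [F, w] <;> ring
  have hlie : ∀ m n : A6, F (m.1 * n.1 - n.1 * m.1) = ⁅F m.1, F n.1⁆ := by
    rintro ⟨m, hm⟩ ⟨n, hn⟩
    have hm : ∀ j, m 2 j = 0 := hm
    have hn : ∀ j, n 2 j = 0 := hn
    refine huniq _ _ ?_ ?_ <;> funext x
    · rw [F0, dirDeriv_lieBracket _ _ hφ, F0, F0, Fw, Fw]
      simp only [w, Matrix.sub_apply, Matrix.mul_apply, Fin.sum_univ_three, hm, hn]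
      ring
    · rw [F1, dirDeriv_lieBracket _ _ hψ, F1, F1, Fw, Fw]
      simp only [w, Matrix.sub_apply, Matrix.mul_apply, Fin.sum_univ_three, hm, hn]
      ring
  let Φ : A6 →ₗ⁅ℝ⁆ killingA ξ :=
    { toFun := fun m => ⟨F m.1, hF m.1⟩
      map_add' := fun m n => Subtype.ext (hadd _ _)
      map_smul' := fun r m => Subtype.ext (hsmul _ _)
      map_lie' := fun {m n} => Subtype.ext (hlie m n) }
  have hinj : ∀ m : Matrix (Fin 3) (Fin 3) ℝ, F m = 0 → ∀ a : Fin 2, ∀ j,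
      m a.castSucc j = 0 := by
    intro m hm
    have h0 : ∀ x, dirDeriv (0 : SmoothField).1 φ x = 0 := fun x => by simp [dirDeriv]
    have h1 : ∀ x, dirDeriv (0 : SmoothField).1 ψ x = 0 := fun x => by simp [dirDeriv]
    have hw0 : ∀ a : Fin 2, w a.castSucc m = fun _ => 0 := by
      refine Fin.forall_fin_two.2 ⟨?_, ?_⟩ <;> funext x
      · rw [← h0 x, ← hm, F0]
        rfl
      · rw [← h1 x, ← hm, F1]
        rfl
    intro a
    have e : ∀ i, -(m a.castSucc 0 * pd i φ 0 + m a.castSucc 1 * pd i ψ 0) = 0 := fun i => by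
      have := congrFun (w1 a.castSucc m i) 0
      rw [hw0, pd_zero] at this
      exact this.symm
    have e' := eq_of_mul_jacobian (p := pd 0 φ 0) (q := pd 1 φ 0) (r := pd 0 ψ 0) (s := pd 1 ψ 0)
      (a := m a.castSucc 0) (b := m a.castSucc 1) (c := 0) (d := 0)
      (fun h => hJ 0 (by linear_combination h)) (by linarith [e 0]) (by linarith [e 1])
    have e2 := congrFun (hw0 a) 0
    simp only [w, e'.1, e'.2] at e2
    have e3 : m a.castSucc 2 = 0 := by linarith
    intro j
    fin_cases j
    exacts [e'.1, e'.2, e3]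
  have hΦ : Function.Injective Φ := by
    rw [injective_iff_map_eq_zero]
    rintro ⟨m, hm⟩ h
    have h1 := hinj m (congrArg Subtype.val h)
    apply Subtype.ext
    ext i j
    exact Fin.lastCases (motive := fun i => m i j = 0) (hm j) (fun a => h1 a j) i
  -- surjectivity by comparison of dimensions: one-jets bound the Killing algebra by `2 + 4`
  have hA6 : 6 ≤ Module.finrank ℝ A6 := by
    let r : A6 →ₗ[ℝ] (Fin 2 → Fin 3 → ℝ) :=
      { toFun := fun m a j => m.1 a.castSucc j
        map_add' := fun _ _ => rfl
        map_smul' := fun _ _ => rfl }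
    have hr : Function.Surjective r := fun t =>
      ⟨⟨Matrix.of ![t 0, t 1, 0], fun _ => rfl⟩, funext (Fin.forall_fin_two.2 ⟨rfl, rfl⟩)⟩
    simpa [Module.finrank_pi_fintype] using LinearMap.finrank_le_finrank_of_surjective hr
  have hle : Module.finrank ℝ A6 ≤ Module.finrank ℝ (killingA ξ) :=
    LinearMap.finrank_le_finrank_of_injective (f := Φ.toLinearMap) hΦ
  have heq := le_antisymm hle ((finrank_killingA_le ξ).trans hA6)
  have hs : Function.Surjective Φ.toLinearMap :=
    (LinearMap.injective_iff_surjective_of_finrank_eq_finrank heq).1 hΦ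
  exact ⟨(LieEquiv.ofBijective Φ ⟨hΦ, hs⟩).symm⟩

/-- The models `M⁶ᵢ(0)` have two affine functions that are globally independent, built from
exponentials, trigonometric functions and polynomials. -/
theorem M6_lieEquiv (i : Fin 6) : Nonempty (killingA (M6 i 0 0) ≃ₗ⁅ℝ⁆ A6) := by
  have e := contDiff_coord
  fin_cases i
  · change Nonempty (killingA (M60 0 0) ≃ₗ⁅ℝ⁆ A6)
    refine flat_lieEquiv (φ := fun x => x 0) (ψ := fun x => x 1) (e 0) (e 1) ?_ ?_ ?_ <;>
      simp [IsAffineFunction, Fin.forall_fin_two, christoffelA, M60, pd_coord,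
        pd_const]
  · change Nonempty (killingA (M61 0 0) ≃ₗ⁅ℝ⁆ A6)
    refine flat_lieEquiv (φ := fun x => Real.exp (x 0)) (ψ := fun x => x 1 * Real.exp (x 0))
      (by fun_prop) (by fun_prop) ?_ ?_ ?_ <;>
      simp (disch := fun_prop) [IsAffineFunction, Fin.forall_fin_two, Fin.sum_univ_two,
        christoffelA, M61, pd_coord, pd_const, pd_exp, pd_mul]
  · change Nonempty (killingA (M62 0 0) ≃ₗ⁅ℝ⁆ A6)
    refine flat_lieEquiv (φ := fun x => Real.exp (-x 0)) (ψ := fun x => Real.exp (x 1))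
      (by fun_prop) (by fun_prop) ?_ ?_ ?_ <;>
      simp (disch := fun_prop) [IsAffineFunction, Fin.forall_fin_two,
        christoffelA, M62, pd_coord, pd_const, pd_exp, pd_neg]
  · change Nonempty (killingA (M63 0 0) ≃ₗ⁅ℝ⁆ A6)
    refine flat_lieEquiv (φ := fun x => x 0) (ψ := fun x => Real.exp (x 1))
      (by fun_prop) (by fun_prop) ?_ ?_ ?_ <;>
      simp (disch := fun_prop) [IsAffineFunction, Fin.forall_fin_two,
        christoffelA, M63, pd_coord, pd_const, pd_exp]
  · change Nonempty (killingA (M64 0 0) ≃ₗ⁅ℝ⁆ A6)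
    refine flat_lieEquiv (φ := fun x => x 1) (ψ := fun x => x 0 + 1 / 2 * (x 1 * x 1))
      (by fun_prop) (by fun_prop) ?_ ?_ ?_ <;>
      simp (disch := fun_prop) [IsAffineFunction, Fin.forall_fin_two, Fin.sum_univ_two,
        christoffelA, M64, pd_coord, pd_const, pd_mul, pd_add]
    norm_num
  · change Nonempty (killingA (M65 0 0) ≃ₗ⁅ℝ⁆ A6)
    refine flat_lieEquiv (φ := fun x => Real.exp (x 0) * Real.cos (x 1))
      (ψ := fun x => Real.exp (x 0) * Real.sin (x 1)) (by fun_prop) (by fun_prop) ?_ ?_ ?_ <;>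
      simp (disch := fun_prop) [IsAffineFunction, Fin.forall_fin_two, Fin.sum_univ_two,
        christoffelA, M65, pd_coord, pd_exp, pd_mul, pd_cos, pd_sin, pd_neg]
    · exact ⟨fun x => mul_comm _ _, fun x => mul_comm _ _⟩
    · exact ⟨fun x => mul_comm _ _, fun x => mul_comm _ _⟩
    · intro x h
      have h2 : Real.exp (x 0) ^ 2 = 0 := by
        linear_combination h - Real.exp (x 0) ^ 2 * Real.sin_sq_add_cos_sq (x 1)
      exact (pow_pos (Real.exp_pos (x 0)) 2).ne' h2

end AffineFunctions

/-! ### Explicit linear equivalences -/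

/-- The vectors `(p, r)` and `(q, s)` form a basis in which the connection `ξ` has the Christoffel
symbols `η`. -/
lemma linEquivA_of_columns {η ξ : Fin 8 → ℝ} (p q r s : ℝ) (hdet : p * s - q * r ≠ 0)
    (h1 : p * η 0 + q * η 1 = p * (p * ξ 0 + r * ξ 2) + r * (p * ξ 4 + r * ξ 6) ∧
      r * η 0 + s * η 1 = p * (p * ξ 1 + r * ξ 3) + r * (p * ξ 5 + r * ξ 7))
    (h2 : p * η 2 + q * η 3 = p * (q * ξ 0 + s * ξ 2) + r * (q * ξ 4 + s * ξ 6) ∧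
      r * η 2 + s * η 3 = p * (q * ξ 1 + s * ξ 3) + r * (q * ξ 5 + s * ξ 7))
    (h3 : p * η 4 + q * η 5 = q * (p * ξ 0 + r * ξ 2) + s * (p * ξ 4 + r * ξ 6) ∧
      r * η 4 + s * η 5 = q * (p * ξ 1 + r * ξ 3) + s * (p * ξ 5 + r * ξ 7))
    (h4 : p * η 6 + q * η 7 = q * (q * ξ 0 + s * ξ 2) + s * (q * ξ 4 + s * ξ 6) ∧
      r * η 6 + s * η 7 = q * (q * ξ 1 + s * ξ 3) + s * (q * ξ 5 + s * ξ 7)) :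
    LinEquivA η ξ := by
  refine linEquivA_of_det_ne_zero !![p, q; r, s] (by rwa [Matrix.det_fin_two_of])
    (linEquivA_rel_iff.1 ?_)
  simp only [Fin.forall_fin_two, Fin.sum_univ_two, christoffelA, Matrix.cons_val, Matrix.of_apply]
  refine ⟨⟨⟨?_, ?_⟩, ?_, ?_⟩, ⟨?_, ?_⟩, ?_, ?_⟩
  · linear_combination h1.1
  · linear_combination h1.2
  · linear_combination h2.1
  · linear_combination h2.2
  · linear_combination h3.1
  · linear_combination h3.2
  · linear_combination h4.1
  · linear_combination h4.2

lemma LinEquivA.refl (ξ : Fin 8 → ℝ) : LinEquivA ξ ξ := by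
  refine linEquivA_of_columns 1 0 0 1 (by norm_num) ?_ ?_ ?_ ?_ <;> simp

/-- The change of basis to `l ∂₁`, `v ∂₂ + m ∂₁`, which preserves the ideal spanned by `∂₁`. -/
lemma idealModel_linEquivA {a c t n d a' c' t' n' d' : ℝ} (l m v : ℝ) (hl : l ≠ 0) (hv : v ≠ 0)
    (ha : a' = l * a) (hc : c' = v * c + m * a) (ht : t' = v * t) (hd : d' = v * d)
    (hn : l * n' = v ^ 2 * n - v * m * (d - 2 * c) + m ^ 2 * a) :
    LinEquivA (idealModel a c t n d) (idealModel a' c' t' n' d') := by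
  subst ha hc ht hd
  refine LinEquivA.symm (linEquivA_of_columns l m 0 v ?_ ?_ ?_ ?_ ?_)
  · simpa using ⟨hl, hv⟩
  all_goals
    simp only [idealModel, Matrix.cons_val]
    constructor <;> first | linear_combination hn | ring

lemma M62_swap (ε : ℝ) : LinEquivA (M62 0 ε) (M62 ε 0) := by
  refine linEquivA_of_columns 0 (-1) (-1) 0 (by norm_num) ?_ ?_ ?_ ?_ <;> simp [M62]

lemma M61_linEquivA (ε : ℝ) : LinEquivA (M61 0 ε) (idealModel 0 (-1) ε 0 (1 + 2 * (-1))) := by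
  refine linEquivA_of_columns 0 1 (-1) 0 (by norm_num) ?_ ?_ ?_ ?_ <;> simp [M61, idealModel] <;>
    ring

lemma M63_linEquivA (ε : ℝ) : LinEquivA (M63 0 ε) (idealModel (-1) 0 (-ε) 0 (2 * 0)) := by
  refine linEquivA_of_columns 0 (-1) 1 0 (by norm_num) ?_ ?_ ?_ ?_ <;> simp [M63, idealModel]

lemma M62_linEquivA (ε : ℝ) : LinEquivA (M62 (-ε) 0) (idealModel (-1) (-1) ε 0 (1 + 2 * (-1))) := by
  refine linEquivA_of_columns 1 1 0 (-1) (by norm_num) ?_ ?_ ?_ ?_ <;> simp [M62, idealModel]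
  ring

lemma M60_linEquivA {a b : ℝ} (h : (a, b) ≠ (0, 0)) : LinEquivA (M60 1 0) (M60 a b) := by
  have h0 : a ^ 2 + b ^ 2 ≠ 0 := by
    intro h0
    apply h
    rw [Prod.mk.injEq]
    constructor <;> nlinarith [sq_nonneg a, sq_nonneg b]
  have h1 : a * (a / (a ^ 2 + b ^ 2)) - -b / (a ^ 2 + b ^ 2) * b = 1 := by
    field_simp
    ring
  refine linEquivA_of_columns a (-b / (a ^ 2 + b ^ 2)) b (a / (a ^ 2 + b ^ 2)) (by simp [h1])
    ?_ ?_ ?_ ?_ <;> simp only [M60, Matrix.cons_val] <;> constructor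
  · ring
  · ring
  · linear_combination -a * h1
  · linear_combination -b * h1
  · linear_combination a * h1
  · linear_combination b * h1
  · ring
  · ring

lemma M42_eq (c t : ℝ) : M42 c t 0 = idealModel (-1) c t 0 (1 + 2 * c) := by simp [M42, idealModel]
lemma M43_eq (c t : ℝ) : M43 c t 0 = idealModel 0 c t 0 (1 + 2 * c) := by simp [M43, idealModel]
lemma M62_eq (ε : ℝ) : M62 ε 0 = idealModel (-1) 0 ε 0 (1 + 2 * 0) := by simp [M62, idealModel]
lemma M63_eq (ε : ℝ) : M63 ε 0 = idealModel 0 0 ε 0 (1 + 2 * 0) := by simp [M63, idealModel]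
lemma M60_eq (ε : ℝ) : M60 ε 0 = idealModel 0 0 ε 0 (2 * 0) := by simp [M60, idealModel]
lemma M64_eq (ε : ℝ) : M64 ε 0 = idealModel 0 0 ε 1 (2 * 0) := by simp [M64, idealModel]
lemma M41_eq (t : ℝ) : M41 t 0 = idealModel (-1) 1 t 0 (2 * 1) := by simp [M41, idealModel]
lemma M44_eq (c t : ℝ) : M44 c t 0 = idealModel 0 1 t c (2 * 1) := by simp [M44, idealModel]
lemma M45_eq (c t : ℝ) : M45 c t 0 = idealModel 1 0 t (1 + c ^ 2) (2 * c) := by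
  simp [M45, idealModel]

/-! ### The three classes of models with four-dimensional Killing algebra -/

/-- `ξ` is linearly equivalent to a listed model with Killing algebra `𝔎_B ⊕ 𝔎_B`. -/
def IsKBKBModel (ξ : Fin 8 → ℝ) : Prop :=
  (∃ ε : ℝ, ε ≠ 0 ∧ (LinEquivA ξ (M61 0 ε) ∨ LinEquivA ξ (M62 0 ε) ∨ LinEquivA ξ (M62 ε 0) ∨
    LinEquivA ξ (M63 ε 0))) ∨
  (∃ c t : ℝ, c ≠ 0 ∧ c ≠ -1 ∧ (LinEquivA ξ (M42 c t 0) ∨ LinEquivA ξ (M43 c t 0)))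

/-- `ξ` is linearly equivalent to a listed model with Killing algebra `A⁰_{4,9}`. -/
def IsA49Model (ξ : Fin 8 → ℝ) : Prop :=
  (∃ ε₁ ε₂ : ℝ, (ε₁, ε₂) ≠ (0, 0) ∧ LinEquivA ξ (M60 ε₁ ε₂)) ∨
  (∃ ε : ℝ, ε ≠ 0 ∧ (LinEquivA ξ (M63 0 ε) ∨ LinEquivA ξ (M64 ε 0))) ∨
  (∃ t : ℝ, LinEquivA ξ (M41 t 0)) ∨
  (∃ c t : ℝ, LinEquivA ξ (M44 c t 0))

/-- `ξ` is linearly equivalent to a listed model with Killing algebra `A_{4,12}`. -/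
def IsA412Model (ξ : Fin 8 → ℝ) : Prop := ∃ c t : ℝ, LinEquivA ξ (M45 c t 0)

lemma IsKBKBModel.of_linEquivA {ξ η : Fin 8 → ℝ} (h : LinEquivA ξ η) :
    IsKBKBModel η → IsKBKBModel ξ := by
  rintro (⟨ε, hε, H⟩ | ⟨c, t, h0, h1, H⟩)
  · exact Or.inl ⟨ε, hε, H.imp h.trans (.imp h.trans (.imp h.trans h.trans))⟩
  · exact Or.inr ⟨c, t, h0, h1, H.imp h.trans h.trans⟩

lemma IsA49Model.of_linEquivA {ξ η : Fin 8 → ℝ} (h : LinEquivA ξ η) :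
    IsA49Model η → IsA49Model ξ := by
  rintro (⟨ε₁, ε₂, hε, H⟩ | ⟨ε, hε, H⟩ | ⟨t, H⟩ | ⟨c, t, H⟩)
  · exact Or.inl ⟨ε₁, ε₂, hε, h.trans H⟩
  · exact Or.inr (Or.inl ⟨ε, hε, H.imp h.trans h.trans⟩)
  · exact Or.inr (Or.inr (Or.inl ⟨t, h.trans H⟩))
  · exact Or.inr (Or.inr (Or.inr ⟨c, t, h.trans H⟩))

lemma IsA412Model.of_linEquivA {ξ η : Fin 8 → ℝ} (h : LinEquivA ξ η) :
    IsA412Model η → IsA412Model ξ := fun ⟨c, t, H⟩ => ⟨c, t, h.trans H⟩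

lemma LinEquivA.nonempty_lieEquiv_trans {ξ η : Fin 8 → ℝ} (h : LinEquivA ξ η) {L : Type*}
    [LieRing L] [LieAlgebra ℝ L] (h' : Nonempty (killingA η ≃ₗ⁅ℝ⁆ L)) :
    Nonempty (killingA ξ ≃ₗ⁅ℝ⁆ L) :=
  ⟨h.nonempty_lieEquiv.some.trans h'.some⟩

lemma IsKBKBModel.lieEquiv {ξ : Fin 8 → ℝ} (h : IsKBKBModel ξ) :
    Nonempty (killingA ξ ≃ₗ⁅ℝ⁆ KB × KB) := by
  rcases h with ⟨ε, hε, h | h | h | h⟩ | ⟨c, t, h0, h1, h | h⟩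
  · exact (h.trans (M61_linEquivA ε)).nonempty_lieEquiv_trans (idealModel_zero_KBKB (Or.inl hε))
  · exact (h.trans (M62_swap ε)).nonempty_lieEquiv_trans
      (M62_eq ε ▸ idealModel_neg_one_KBKB (Or.inl hε))
  · exact h.nonempty_lieEquiv_trans (M62_eq ε ▸ idealModel_neg_one_KBKB (Or.inl hε))
  · exact h.nonempty_lieEquiv_trans (M63_eq ε ▸ idealModel_zero_KBKB (Or.inl hε))
  all_goals
    have h2 : c * (1 + c) ≠ 0 := mul_ne_zero h0 fun h => h1 (by linarith)
  · exact h.nonempty_lieEquiv_trans (M42_eq c t ▸ idealModel_neg_one_KBKB (Or.inr h2))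
  · exact h.nonempty_lieEquiv_trans (M43_eq c t ▸ idealModel_zero_KBKB (Or.inr h2))

lemma IsA49Model.lieEquiv {ξ : Fin 8 → ℝ} (h : IsA49Model ξ) :
    Nonempty (killingA ξ ≃ₗ⁅ℝ⁆ A49) := by
  rcases h with ⟨ε₁, ε₂, hε, h⟩ | ⟨ε, hε, h | h⟩ | ⟨t, h⟩ | ⟨c, t, h⟩
  · exact (h.trans (M60_linEquivA hε).symm).nonempty_lieEquiv_trans
      (M60_eq 1 ▸ idealModel_zero_A49 (Or.inl one_ne_zero))
  · exact (h.trans (M63_linEquivA ε)).nonempty_lieEquiv_trans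
      (idealModel_neg_one_A49 (Or.inl (neg_ne_zero.2 hε)))
  · exact h.nonempty_lieEquiv_trans (M64_eq ε ▸ idealModel_zero_A49 (Or.inl hε))
  · exact h.nonempty_lieEquiv_trans (M41_eq t ▸ idealModel_neg_one_A49 (Or.inr one_ne_zero))
  · exact h.nonempty_lieEquiv_trans (M44_eq c t ▸ idealModel_zero_A49 (Or.inr one_ne_zero))

lemma IsA412Model.lieEquiv {ξ : Fin 8 → ℝ} (h : IsA412Model ξ) :
    Nonempty (killingA ξ ≃ₗ⁅ℝ⁆ A412) := by
  obtain ⟨c, t, h⟩ := h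
  exact h.nonempty_lieEquiv_trans (M45_eq c t ▸ idealModel_A412)

/-! ### Normal forms of `idealModel` -/

/-- Killing fields `f ∂₁` of `idealModel` satisfy a linear second order equation along `∂₂`; the
sign of its discriminant `(d - 2 c)² - 4 n a` and the vanishing of `a` decide the type. -/
theorem idealModel_normalForm {a c t n d : ℝ} (hnd : t ≠ 0 ∨ n * a + c * (d - c) ≠ 0) :
    IsKBKBModel (idealModel a c t n d) ∨ IsA49Model (idealModel a c t n d) ∨
      IsA412Model (idealModel a c t n d) := by
  by_cases ha : a = 0
  · subst ha
    by_cases hk : d - 2 * c = 0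
    · obtain rfl : d = 2 * c := by linarith
      right; left
      by_cases hc : c = 0
      · subst hc
        have ht : t ≠ 0 := hnd.resolve_right (by simp)
        by_cases hn : n = 0
        · subst hn
          exact Or.inl ⟨t, 0, by simpa using ht, M60_eq t ▸ LinEquivA.refl _⟩
        · refine Or.inr (Or.inl ⟨t, ht, Or.inr (M64_eq t ▸ ?_)⟩)
          exact idealModel_linEquivA n 0 1 hn one_ne_zero (by ring) (by ring) (by ring) (by ring)
            (by ring)
      · refine Or.inr (Or.inr (Or.inr ⟨1 / c ^ 2 * n, 1 / c * t, M44_eq _ _ ▸ ?_⟩))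
        exact idealModel_linEquivA 1 0 (1 / c) one_ne_zero (by simpa using hc) (by ring)
          (by field_simp; ring) (by ring) (by field_simp) (by field_simp; ring)
    -- `d - 2 c` is scaled to `1`, and `n` is removed
    · left
      have hv : 1 / (d - 2 * c) ≠ 0 := one_div_ne_zero hk
      have key := idealModel_linEquivA (a := 0) (c := c) (t := t) (n := n) (d := d) (n' := 0)
        (c' := c / (d - 2 * c)) (d' := 1 + 2 * (c / (d - 2 * c))) (t' := t / (d - 2 * c))
        1 (n / (d - 2 * c) ^ 2) (1 / (d - 2 * c)) one_ne_zero hv (mul_zero _).symm (by ring)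
        (by ring) (by field_simp; ring) (by field_simp; ring)
      have ht : c / (d - 2 * c) * (1 + c / (d - 2 * c)) = 0 → t / (d - 2 * c) ≠ 0 := by
        intro h
        refine div_ne_zero (hnd.resolve_right ?_) hk
        have e : 1 + c / (d - 2 * c) = (d - c) / (d - 2 * c) := by
          rw [eq_div_iff hk, add_mul, div_mul_cancel₀ _ hk]
          ring
        rw [e, div_mul_div_comm, div_eq_zero_iff] at h
        rw [ne_eq, not_not, mul_zero, zero_add]
        exact h.resolve_right (mul_ne_zero hk hk)
      generalize c / (d - 2 * c) = c' at *
      generalize t / (d - 2 * c) = t' at *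
      by_cases h0 : c' = 0
      · subst h0
        exact Or.inl ⟨t', ht (by simp), Or.inr (Or.inr (Or.inr (M63_eq t' ▸ key)))⟩
      by_cases h1 : c' = -1
      · subst h1
        exact Or.inl ⟨t', ht (by simp), Or.inl (key.trans (M61_linEquivA t').symm)⟩
      exact Or.inr ⟨c', t', h0, h1, Or.inr (M43_eq c' t' ▸ key)⟩
  rcases lt_trichotomy ((d - 2 * c) ^ 2 - 4 * n * a) 0 with hD | hD | hD
  -- the root `w` of the absolute value of the discriminant is scaled to `2` here, to `1` below
  · right; right
    obtain ⟨w, hw, hw2⟩ : ∃ w : ℝ, 0 < w ∧ w ^ 2 = -((d - 2 * c) ^ 2 - 4 * n * a) :=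
      ⟨√(-((d - 2 * c) ^ 2 - 4 * n * a)), Real.sqrt_pos.2 (by linarith),
        Real.sq_sqrt (by linarith)⟩
    refine ⟨d / w, 2 / w * t, M45_eq _ _ ▸ ?_⟩
    refine idealModel_linEquivA (1 / a) (-(2 / w) * c / a) (2 / w) (by simpa using ha)
      (by positivity) (by field_simp) (by field_simp; ring) rfl (by ring) ?_
    field_simp
    linear_combination hw2
  · right; left
    have hn : n = (d - 2 * c) ^ 2 / (4 * a) := by
      field_simp
      linarith
    by_cases hd : d = 0
    · have ht : t ≠ 0 := by
        refine hnd.resolve_right ?_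
        subst hd
        rw [ne_eq, not_not]
        linarith
      refine Or.inr (Or.inl ⟨-t, neg_ne_zero.2 ht, Or.inl ?_⟩)
      refine LinEquivA.trans ?_ (M63_linEquivA (-t)).symm
      subst hd hn
      exact idealModel_linEquivA (-1 / a) (-c / a) 1 (by simpa using ha) one_ne_zero
        (by field_simp) (by field_simp; ring) (by ring) (by ring) (by field_simp; ring)
    · refine Or.inr (Or.inr (Or.inl ⟨2 / d * t, M41_eq _ ▸ ?_⟩))
      subst hn
      exact idealModel_linEquivA (-1 / a) (2 / d * (d - 2 * c) / (2 * a)) (2 / d)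
        (by simpa using ha) (by simpa using hd) (by field_simp) (by field_simp; ring) rfl
        (by field_simp) (by field_simp; ring)
  · left
    obtain ⟨w, hw, hw2⟩ : ∃ w : ℝ, 0 < w ∧ w ^ 2 = (d - 2 * c) ^ 2 - 4 * n * a :=
      ⟨√((d - 2 * c) ^ 2 - 4 * n * a), Real.sqrt_pos.2 hD, Real.sq_sqrt hD.le⟩
    have hn : n = ((d - 2 * c) ^ 2 - w ^ 2) / (4 * a) := by
      field_simp
      linarith
    have key := idealModel_linEquivA (a := a) (c := c) (t := t) (n := n) (d := d) (n' := 0)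
      (a' := -1) (c' := (d - w) / (2 * w)) (d' := 1 + 2 * ((d - w) / (2 * w))) (t' := 1 / w * t)
      (-1 / a) (1 / w * (d - 2 * c - w) / (2 * a)) (1 / w) (by simpa using ha) (by positivity)
      (by field_simp) (by field_simp; ring) rfl (by field_simp; ring)
      (by subst hn; field_simp; ring)
    have ht : (d - w) / (2 * w) * (1 + (d - w) / (2 * w)) = 0 → 1 / w * t ≠ 0 := by
      intro h
      refine mul_ne_zero (by positivity) (hnd.resolve_right ?_)
      field_simp at h
      rw [ne_eq, not_not]
      linear_combination h / 4 + hw2 / 4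
    generalize (d - w) / (2 * w) = c' at *
    generalize 1 / w * t = t' at *
    by_cases h0 : c' = 0
    · subst h0
      exact Or.inl ⟨t', ht (by simp), Or.inr (Or.inr (Or.inl (M62_eq t' ▸ key)))⟩
    by_cases h1 : c' = -1
    · subst h1
      exact Or.inl ⟨-t', neg_ne_zero.2 (ht (by simp)),
        Or.inr (Or.inr (Or.inl (key.trans (M62_linEquivA t').symm)))⟩
    exact Or.inr ⟨c', t', h0, h1, Or.inl (M42_eq c' t' ▸ key)⟩

/-! ### Torsion and Ricci tensor under linear changes of coordinates -/

lemma torsion_transform {ξ η : Fin 8 → ℝ} {Q : Matrix (Fin 2) (Fin 2) ℝ}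
    (h : ∀ i, Q * leftMul ξ i = (∑ p, Q p i • leftMul η p) * Q) (k : Fin 2) :
    ∑ l, Q k l * torsionA ξ l = Q.det * torsionA η k := by
  have h1 := linEquivA_rel_iff.2 h 0 1 k
  have h2 := linEquivA_rel_iff.2 h 1 0 k
  simp only [Fin.sum_univ_two, torsionA, Matrix.det_fin_two] at *
  linear_combination (h1 - h2) / 2

/-- The Ricci tensor of a Type A model without torsion. -/
def ricciA (ξ : Fin 8 → ℝ) (i j : Fin 2) : ℝ :=
  ∑ l, christoffelA ξ i j l * (leftMul ξ l).trace - (leftMul ξ i * leftMul ξ j).trace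

lemma christoffelA_comm {ξ : Fin 8 → ℝ} (h : ∀ i, torsionA ξ i = 0) (k : Fin 2) :
    christoffelA ξ 1 0 k = christoffelA ξ 0 1 k := by
  have := h k
  rw [torsionA] at this
  linarith

lemma torsion_eq_zero_of_transform {ξ η : Fin 8 → ℝ} {Q : Matrix (Fin 2) (Fin 2) ℝ}
    (hQ : Q.det ≠ 0) (h : ∀ i, Q * leftMul ξ i = (∑ p, Q p i • leftMul η p) * Q)
    (hη : ∀ k, torsionA η k = 0) (k : Fin 2) : torsionA ξ k = 0 := by
  have e : Q.mulVec (torsionA ξ) = 0 := funext fun k =>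
    (torsion_transform h k).trans (by rw [hη, mul_zero, Pi.zero_apply])
  exact congrFun (Matrix.eq_zero_of_mulVec_eq_zero hQ e) k

lemma ricci_transform {ξ η : Fin 8 → ℝ} {Q : Matrix (Fin 2) (Fin 2) ℝ} (hQ : Q.det ≠ 0)
    (h : ∀ i, Q * leftMul ξ i = (∑ p, Q p i • leftMul η p) * Q) (i j : Fin 2) :
    ricciA ξ i j = ∑ p, ∑ q, Q p i * Q q j * ricciA η p q := by
  have hu := isUnit_iff_ne_zero.2 hQ
  have h1 : ∀ i, leftMul ξ i = Q⁻¹ * (∑ p, Q p i • leftMul η p) * Q := fun i => by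
    rw [Matrix.mul_assoc, ← h, ← Matrix.mul_assoc, Matrix.nonsing_inv_mul _ hu, Matrix.one_mul]
  have h2 : ∀ i, (leftMul ξ i).trace = ∑ p, Q p i * (leftMul η p).trace := fun i => by
    rw [h1, Matrix.trace_mul_comm, ← Matrix.mul_assoc, Matrix.mul_nonsing_inv _ hu,
      Matrix.one_mul, Matrix.trace_sum]
    simp
  have h3 : (leftMul ξ i * leftMul ξ j).trace =
      ∑ p, ∑ q, Q p i * Q q j * (leftMul η p * leftMul η q).trace := by
    have : leftMul ξ i * leftMul ξ j =
        Q⁻¹ * ((∑ p, Q p i • leftMul η p) * ∑ q, Q q j • leftMul η q) * Q := by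
      rw [h1 i, Matrix.mul_assoc, Matrix.mul_assoc, h]
      simp only [Matrix.mul_assoc]
    rw [this, Matrix.trace_mul_comm, ← Matrix.mul_assoc, Matrix.mul_nonsing_inv _ hu,
      Matrix.one_mul]
    simp only [Fin.sum_univ_two, Matrix.add_mul, Matrix.mul_add, Matrix.smul_mul, Matrix.mul_smul,
      Matrix.trace_add, Matrix.trace_smul, smul_eq_mul]
    ring
  have h4 := linEquivA_rel_iff.2 h i j
  simp only [ricciA, h2, h3]
  simp only [Fin.sum_univ_two] at h4 ⊢
  linear_combination (leftMul η 0).trace * h4 0 + (leftMul η 1).trace * h4 1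

/-- Without torsion, affine Killing fields preserve the Ricci tensor. -/
lemma ricci_killing {ξ : Fin 8 → ℝ} (hs : ∀ k, christoffelA ξ 1 0 k = christoffelA ξ 0 1 k)
    {v : Plane → Plane} (hv : ContDiff ℝ ∞ v) (kv : IsAffineKilling (modelA ξ) v) (j k : Fin 2)
    (x : Plane) : ∑ l, (ricciA ξ l k * pd j (fun y => v y l) x
      + ricciA ξ j l * pd k (fun y => v y l) x) = 0 := by
  have hc := contDiff_component hv
  have hc1 := fun k i => contDiff_pd (hc k) i
  have D := fun m i j k => killing_deriv _ hv kv m i j k x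
  have K := fun i j k => isAffineKilling_modelA_iff.1 kv i j k x
  simp only [modelA, pd_const, Fin.sum_univ_two, mul_zero, add_zero] at D
  simp only [Fin.sum_univ_two] at K
  have pd10 : ∀ {f : Plane → ℝ}, ContDiff ℝ ∞ f → pd 1 (pd 0 f) = pd 0 (pd 1 f) :=
    fun hf => pd_comm hf 1 0
  have two : ∀ a : Fin 2, a = 0 ∨ a = 1 := by decide
  simp only [ricciA, Fin.sum_univ_two, Matrix.trace, Matrix.diag_apply, Matrix.mul_apply,
    leftMul_apply]
  rcases two j with rfl | rfl
  · have D1 := D 1 0 k 1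
    have D2 := D 0 1 k 1
    have K1 := K 0 k 0
    have K2 := K 0 k 1
    have K3 := K 0 0 1
    have K4 := K 0 1 1
    have K5 := K 1 k 0
    have K6 := K 1 k 1
    have K7 := K 1 0 1
    have K8 := K 1 1 1
    clear D K kv
    rcases two k with rfl | rfl <;>
      simp (disch := fun_prop) only [pd10, hs] at D1 D2 K1 K2 K3 K4 K5 K6 K7 K8 ⊢
    · linear_combination D1 - D2 + christoffelA ξ 0 1 1 * K1 + christoffelA ξ 1 1 1 * K2
        - christoffelA ξ 0 1 0 * K3 - christoffelA ξ 0 1 1 * K4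
        - christoffelA ξ 0 0 1 * K5 - christoffelA ξ 0 1 1 * K6
        + christoffelA ξ 0 0 0 * K7 + christoffelA ξ 0 0 1 * K8
    · linear_combination D1 - D2 + christoffelA ξ 0 1 1 * K1 + christoffelA ξ 1 1 1 * K2
        - christoffelA ξ 1 1 0 * K3 - christoffelA ξ 1 1 1 * K4
        - christoffelA ξ 0 0 1 * K5 - christoffelA ξ 0 1 1 * K6
        + christoffelA ξ 0 1 0 * K7 + christoffelA ξ 0 1 1 * K8
  · have D1 := D 0 1 k 0
    have D2 := D 1 0 k 0
    have K1 := K 1 k 0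
    have K2 := K 1 k 1
    have K3 := K 1 0 0
    have K4 := K 1 1 0
    have K5 := K 0 k 0
    have K6 := K 0 k 1
    have K7 := K 0 0 0
    have K8 := K 0 1 0
    clear D K kv
    rcases two k with rfl | rfl <;>
      simp (disch := fun_prop) only [pd10, hs] at D1 D2 K1 K2 K3 K4 K5 K6 K7 K8 ⊢
    · linear_combination D1 - D2 + christoffelA ξ 0 0 0 * K1 + christoffelA ξ 0 1 0 * K2
        - christoffelA ξ 0 0 0 * K3 - christoffelA ξ 0 0 1 * K4
        - christoffelA ξ 0 1 0 * K5 - christoffelA ξ 1 1 0 * K6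
        + christoffelA ξ 0 1 0 * K7 + christoffelA ξ 0 1 1 * K8
    · linear_combination D1 - D2 + christoffelA ξ 0 0 0 * K1 + christoffelA ξ 0 1 0 * K2
        - christoffelA ξ 0 1 0 * K3 - christoffelA ξ 0 1 1 * K4
        - christoffelA ξ 0 1 0 * K5 - christoffelA ξ 1 1 0 * K6
        + christoffelA ξ 1 1 0 * K7 + christoffelA ξ 1 1 1 * K8

/-! ### Classification -/

lemma torsionA_idealModel {a c t n d : ℝ} : torsionA (idealModel a c t n d) 0 = t := by
  simp [torsionA, christoffelA, idealModel]

lemma ricciA_idealModel {a c t n d : ℝ} (ht : t = 0) :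
    ricciA (idealModel a c t n d) 1 1 = n * a + c * (d - c) := by
  subst ht
  simp [ricciA, christoffelA, idealModel, leftMul, Matrix.trace, Matrix.mul_apply]
  ring

/-- If a Killing field that is not a translation has constant second component and the torsion
points in the direction of `∂₁`, then the Killing equations for the second component force the
shape of `idealModel`. -/
lemma eq_idealModel_of_killing {ξ : Fin 8 → ℝ} (hT : torsionA ξ 1 = 0) {v : Plane → Plane}
    (kv : IsAffineKilling (modelA ξ) v) (hw : ∀ i x, pd i (fun y => v y 1) x = 0)
    {i k : Fin 2} {x : Plane} (hx : pd i (fun y => v y k) x ≠ 0) :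
    ∃ a c t n d, ξ = idealModel a c t n d := by
  have K := fun i j => isAffineKilling_modelA_iff.1 kv i j 1 x
  have hw' : ∀ i, pd i (fun y => v y 1) = fun _ => 0 := fun i => funext (hw i)
  simp only [hw', pd_zero, Fin.sum_univ_two, mul_zero, add_zero, sub_zero, zero_add] at K
  have K00 := K 0 0
  have K01 := K 0 1
  have K11 := K 1 1
  simp only [torsionA, christoffelA, Matrix.cons_val] at hT K00 K01 K11
  have h35 : ξ 5 = ξ 3 := by linarith
  rw [h35] at K11
  have key : ξ 1 = 0 ∧ ξ 3 = 0 := by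
    by_cases h0 : pd 0 (fun y => v y 0) x = 0
    · have h1 : pd 1 (fun y => v y 0) x ≠ 0 := by
        intro h1
        apply hx
        revert i k
        simp only [Fin.forall_fin_two, hw, h0, h1]
        simp
      rw [h0, mul_zero, add_zero] at K01
      exact ⟨(mul_eq_zero.1 K01).resolve_right h1,
        (mul_eq_zero.1 (show ξ 3 * _ = 0 by linarith)).resolve_right h1⟩
    · have e1 : ξ 1 = 0 := (mul_eq_zero.1 (show ξ 1 * _ = 0 by linarith)).resolve_right h0
      rw [e1, zero_mul, zero_add] at K01
      exact ⟨e1, (mul_eq_zero.1 K01).resolve_right h0⟩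
  refine ⟨ξ 0, (ξ 2 + ξ 4) / 2, (ξ 2 - ξ 4) / 2, ξ 6, ξ 7, ?_⟩
  ext m
  fin_cases m <;> simp [idealModel, key, h35] <;> ring

lemma exists_not_translation {ξ : Fin 8 → ℝ} (h : 2 < Module.rank ℝ (killingA ξ)) :
    ∃ v ∈ killingA ξ, ∃ i k x, pd i (fun y => v.1 y k) x ≠ 0 := by
  by_contra! H
  have hle : (killingA ξ).toSubmodule ≤ translations := fun v hv =>
    mem_translations_iff.2 fun i k x => H v hv i k x
  have h1 : Module.rank ℝ (killingA ξ) ≤ Module.rank ℝ translations := Submodule.rank_mono hle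
  have h2 : Module.rank ℝ translations ≤ 2 := by
    refine (rank_span_le _).trans ?_
    exact (Cardinal.mk_insert_le).trans (by rw [Cardinal.mk_singleton]; norm_num)
  exact absurd (h1.trans h2) (not_le.2 h)

lemma LinEquivA.rank_eq {ξ η : Fin 8 → ℝ} (h : LinEquivA ξ η) :
    Module.rank ℝ (killingA ξ) = Module.rank ℝ (killingA η) :=
  h.nonempty_lieEquiv.some.toLinearEquiv.rank_eq

/-- With torsion, choose `∂₁` in the direction of the torsion vector. -/
lemma classification_torsion {ξ : Fin 8 → ℝ} (hT : ∃ i, torsionA ξ i ≠ 0)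
    (h : 2 < Module.rank ℝ (killingA ξ)) : IsKBKBModel ξ ∨ IsA49Model ξ ∨ IsA412Model ξ := by
  have hD : torsionA ξ 0 ^ 2 + torsionA ξ 1 ^ 2 ≠ 0 := by
    intro h0
    obtain ⟨i, hi⟩ := hT
    apply hi
    revert i
    refine Fin.forall_fin_two.2 ⟨fun _ => ?_, fun _ => ?_⟩ <;>
      nlinarith [sq_nonneg (torsionA ξ 0), sq_nonneg (torsionA ξ 1)]
  have hdet : !![torsionA ξ 0, -torsionA ξ 1; torsionA ξ 1, torsionA ξ 0].det ≠ 0 := by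
    rw [Matrix.det_fin_two_of]
    intro h0
    exact hD (by linarith)
  obtain ⟨ξ', hξ, hrel⟩ := exists_linEquivA ξ _ hdet
  have e := torsion_transform hrel
  have e0 := e 0
  have e1 := e 1
  simp only [Fin.sum_univ_two, Matrix.det_fin_two_of, Matrix.of_apply, Matrix.cons_val] at e0 e1
  have t1 : torsionA ξ' 1 = 0 := by
    refine (mul_eq_zero.1 ?_).resolve_left hD
    linear_combination torsionA ξ 0 * e1 - torsionA ξ 1 * e0
  have t0 : torsionA ξ' 0 ≠ 0 := by
    intro t0
    rw [t0, t1] at e0 e1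
    apply hD
    have : (torsionA ξ 0 ^ 2 + torsionA ξ 1 ^ 2) ^ 2 = 0 := by
      linear_combination -torsionA ξ 0 * e0 - torsionA ξ 1 * e1
    exact pow_eq_zero_iff two_ne_zero |>.1 this
  obtain ⟨v, hv, i, k, x, hx⟩ := exists_not_translation (hξ.rank_eq ▸ h)
  have hw : ∀ i x, pd i (fun y => v.1 y 1) x = 0 := by
    intro i x
    have a0 := torsion_killing v.contDiff hv 0 x
    have a1 := torsion_killing v.contDiff hv 1 x
    simp only [Fin.sum_univ_two, t1] at a0 a1
    revert i
    refine Fin.forall_fin_two.2 ⟨?_, ?_⟩ <;> refine (mul_eq_zero.1 ?_).resolve_left t0 <;> linarith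
  obtain ⟨a, c, t, n, d, rfl⟩ := eq_idealModel_of_killing t1 hv hw hx
  rw [torsionA_idealModel] at t0
  exact (idealModel_normalForm (Or.inl t0)).imp (.of_linEquivA hξ.symm)
    (.imp (.of_linEquivA hξ.symm) (.of_linEquivA hξ.symm))

/-- A nonzero symmetric bilinear form on the plane is diagonal in a suitable basis. -/
lemma exists_diagonal {ρ : Fin 2 → Fin 2 → ℝ} (hs : ρ 1 0 = ρ 0 1) (h : ∃ i j, ρ i j ≠ 0) :
    ∃ Q : Matrix (Fin 2) (Fin 2) ℝ, Q.det ≠ 0 ∧ ∑ p, ∑ q, Q p 0 * Q q 1 * ρ p q = 0 ∧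
      ∑ p, ∑ q, Q p 1 * Q q 0 * ρ p q = 0 ∧ ∑ p, ∑ q, Q p 1 * Q q 1 * ρ p q ≠ 0 := by
  by_cases h1 : ρ 1 1 = 0
  · by_cases h0 : ρ 0 0 = 0
    · have h01 : ρ 0 1 ≠ 0 := by
        intro h01
        obtain ⟨i, j, hij⟩ := h
        apply hij
        revert i j
        simp [Fin.forall_fin_two, hs, h0, h1, h01]
      refine ⟨!![1, 1; -1, 1], by norm_num [Matrix.det_fin_two_of], ?_⟩
      simpa [Fin.sum_univ_two, hs, h0, h1] using h01
    · refine ⟨!![-ρ 0 1 / ρ 0 0, 1; 1, 0], by norm_num [Matrix.det_fin_two_of], ?_⟩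
      simp [Fin.sum_univ_two, hs, h0]
  · refine ⟨!![1, 0; -ρ 0 1 / ρ 1 1, 1], by norm_num [Matrix.det_fin_two_of], ?_⟩
    simp [Fin.sum_univ_two, hs, h1]

/-- A Killing field is an infinitesimal isometry of the Ricci tensor. For a definite or indefinite
Ricci tensor this leaves only an infinitesimal rotation, which would have to be a derivation of
the product `∇_x y`; a nonzero commutative product on the plane has no such derivation. -/
lemma ricci_degenerate {ξ : Fin 8 → ℝ} (hs : ∀ k, christoffelA ξ 1 0 k = christoffelA ξ 0 1 k)
    (h01 : ricciA ξ 0 1 = 0) (h10 : ricciA ξ 1 0 = 0) (h11 : ricciA ξ 1 1 ≠ 0)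
    {v : SmoothField} (hv : v ∈ killingA ξ) {i k : Fin 2} {x : Plane}
    (hx : pd i (fun y => v.1 y k) x ≠ 0) : ricciA ξ 0 0 = 0 := by
  by_contra h00
  have hc := contDiff_component v.contDiff
  have R := fun j k x => ricci_killing hs v.contDiff hv j k x
  simp only [Fin.sum_univ_two] at R
  have p00 : pd 0 (fun y => v.1 y 0) = fun _ => 0 := by
    funext x
    have := R 0 0 x
    simp only [h01, h10, zero_mul, add_zero] at this
    exact (mul_eq_zero.1 (show ricciA ξ 0 0 * _ = 0 by linarith)).resolve_left h00
  have p11 : pd 1 (fun y => v.1 y 1) = fun _ => 0 := by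
    funext x
    have := R 1 1 x
    simp only [h01, h10, zero_mul, add_zero, zero_add] at this
    exact (mul_eq_zero.1 (show ricciA ξ 1 1 * _ = 0 by linarith)).resolve_left h11
  let m := ricciA ξ 1 1 / ricciA ξ 0 0
  have hm : m ≠ 0 := div_ne_zero h11 h00
  have p10 : pd 1 (fun y => v.1 y 0) = fun y => -m * pd 0 (fun y => v.1 y 1) y := by
    funext x
    have := R 0 1 x
    simp only [h01, zero_mul, add_zero, zero_add] at this
    simp only [m]
    field_simp
    linarith
  have q00 : pd 0 (pd 0 (fun y => v.1 y 1)) = fun _ => 0 := by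
    have e := pd_comm (hc 0) 0 1
    rw [p00, p10, pd_zero, pd_const_mul (contDiff_pd (hc 1) 0)] at e
    funext x
    have := congrFun e x
    exact (mul_eq_zero.1 this).resolve_left (neg_ne_zero.2 hm)
  have q10 : pd 1 (pd 0 (fun y => v.1 y 1)) = fun _ => 0 := by
    rw [pd_comm (hc 1) 1 0, p11, pd_zero]
  have hf : pd 0 (fun y => v.1 y 1) x ≠ 0 := by
    intro h0
    apply hx
    revert i k
    simp [Fin.forall_fin_two, p00, p11, p10, h0]
  have K := fun i j k => isAffineKilling_modelA_iff.1 hv i j k x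
  have K1 := K 0 0 0
  have K2 := K 0 0 1
  have K3 := K 0 1 0
  have K4 := K 0 1 1
  have K5 := K 1 1 0
  have K6 := K 1 1 1
  clear K R
  simp only [Fin.sum_univ_two, p00, p11, p10, pd_zero, hs,
    pd_const_mul (contDiff_pd (hc 1) 0), q00, q10, mul_zero, zero_add, add_zero, zero_sub]
    at K1 K2 K3 K4 K5 K6
  have cancel : ∀ {a : ℝ}, pd 0 (fun y => v.1 y 1) x * a = 0 → a = 0 := fun h =>
    (mul_eq_zero.1 h).resolve_left hf
  have k1 : m * christoffelA ξ 0 0 1 + 2 * christoffelA ξ 0 1 0 = 0 :=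
    cancel (by linear_combination K1)
  have k2 : -christoffelA ξ 0 0 0 + 2 * christoffelA ξ 0 1 1 = 0 :=
    cancel (by linear_combination K2)
  have k3 : m * christoffelA ξ 0 1 1 - m * christoffelA ξ 0 0 0 + christoffelA ξ 1 1 0 = 0 :=
    cancel (by linear_combination K3)
  have k4 : -christoffelA ξ 0 1 0 - m * christoffelA ξ 0 0 1 + christoffelA ξ 1 1 1 = 0 :=
    cancel (by linear_combination K4)
  have k5 : m * christoffelA ξ 1 1 1 - 2 * m * christoffelA ξ 0 1 0 = 0 :=
    cancel (by linear_combination K5)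
  have k6 : -christoffelA ξ 1 1 0 - 2 * m * christoffelA ξ 0 1 1 = 0 :=
    cancel (by linear_combination K6)
  -- `k1` to `k6` say that the rotation is a derivation; together they make the product vanish
  have z1 : christoffelA ξ 0 1 1 = 0 := (mul_eq_zero.1 (show m * christoffelA ξ 0 1 1 = 0 by
    linear_combination (m * k2 - k3 - k6) / 3)).resolve_left hm
  have z2 : christoffelA ξ 1 1 1 - 2 * christoffelA ξ 0 1 0 = 0 :=
    (mul_eq_zero.1 (show m * _ = 0 by linear_combination k5)).resolve_left hm
  have z3 : christoffelA ξ 0 1 0 = 0 := by linarith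
  have z4 : christoffelA ξ 1 1 0 = 0 := by
    rw [z1] at k6
    linarith
  have z5 : christoffelA ξ 1 1 1 = 0 := by linarith
  apply h11
  simp [ricciA, Matrix.trace, Matrix.mul_apply, leftMul_apply, hs, z1, z3, z4, z5]

/-- Without torsion, choose a basis that diagonalizes the Ricci tensor. It is degenerate, and the
kernel of the Ricci tensor takes over the role of the torsion vector. -/
lemma classification_ricci {ξ : Fin 8 → ℝ} (hT : ∀ i, torsionA ξ i = 0)
    (hR : ∃ i j, ricciA ξ i j ≠ 0) (h : 2 < Module.rank ℝ (killingA ξ)) :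
    IsKBKBModel ξ ∨ IsA49Model ξ ∨ IsA412Model ξ := by
  have hs : ricciA ξ 1 0 = ricciA ξ 0 1 := by
    simp only [ricciA, christoffelA_comm hT]
    rw [Matrix.trace_mul_comm]
  obtain ⟨Q, hQ, q01, q10, q11⟩ := exists_diagonal hs hR
  obtain ⟨ξ', hξ, hrel⟩ := exists_linEquivA ξ Q hQ
  have hT' := torsion_eq_zero_of_transform hQ hrel hT
  rw [← ricci_transform hQ hrel] at q01 q10 q11
  obtain ⟨v, hv, i, k, x, hx⟩ := exists_not_translation (hξ.rank_eq ▸ h)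
  have q00 := ricci_degenerate (christoffelA_comm hT') q01 q10 q11 hv hx
  have hw : ∀ i x, pd i (fun y => v.1 y 1) x = 0 := by
    intro i x
    have R := fun j k => ricci_killing (christoffelA_comm hT') v.contDiff hv j k x
    have R1 := R 0 1
    have R2 := R 1 1
    simp only [Fin.sum_univ_two, q00, q01, q10, zero_mul, add_zero, zero_add] at R1 R2
    revert i
    refine Fin.forall_fin_two.2 ⟨?_, ?_⟩ <;> refine (mul_eq_zero.1 ?_).resolve_left q11 <;> linarith
  obtain ⟨a, c, t, n, d, rfl⟩ := eq_idealModel_of_killing (hT' 1) hv hw hx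
  have ht : t = 0 := torsionA_idealModel.symm.trans (hT' 0)
  rw [ricciA_idealModel ht] at q11
  exact (idealModel_normalForm (Or.inr q11)).imp (.of_linEquivA hξ.symm)
    (.imp (.of_linEquivA hξ.symm) (.of_linEquivA hξ.symm))

/-! ### Flat models and commutative associative algebras -/

/-- The maximal ideal of `ℝ[z] / (z³ - d z² - c z)` with basis `z`, `z²`. -/
def cubicModel (c d : ℝ) : Fin 8 → ℝ := ![0, 1, c, d, c, d, c * d, c + d ^ 2]

/-- The splitting behaviour of `z (z² - d z - c)` decides which algebra arises. -/
lemma cubicModel_normalForm (c d : ℝ) : ∃ i : Fin 6, LinEquivA (M6 i 0 0) (cubicModel c d) := by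
  by_cases hc : c = 0
  · subst hc
    by_cases hd : d = 0
    · subst hd
      refine ⟨4, linEquivA_of_columns 0 1 1 0 (by norm_num) ?_ ?_ ?_ ?_⟩ <;>
        simp [M6, M64, cubicModel]
    · refine ⟨3, linEquivA_of_columns (-d) 0 1 (1 / d ^ 2) (by simpa using hd) ?_ ?_ ?_ ?_⟩ <;>
        simp only [M6, M63, cubicModel, Matrix.cons_val] <;> constructor <;> field_simp <;> ring
  rcases lt_trichotomy (d ^ 2 + 4 * c) 0 with hD | hD | hD
  -- nonreal roots `s ± i w`: the field `ℂ`, whose unit becomes `∂₁`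
  · obtain ⟨w, hw, hw2⟩ : ∃ w : ℝ, 0 < w ∧ w ^ 2 = -(d ^ 2 + 4 * c) / 4 :=
      ⟨√(-(d ^ 2 + 4 * c) / 4), Real.sqrt_pos.2 (by linarith), Real.sq_sqrt (by linarith)⟩
    obtain ⟨s, rfl⟩ : ∃ s, d = 2 * s := ⟨d / 2, by ring⟩
    obtain rfl : c = -(s ^ 2 + w ^ 2) := by linarith
    have hN : s ^ 2 + w ^ 2 ≠ 0 := by positivity
    refine ⟨5, linEquivA_of_columns (2 * s / (s ^ 2 + w ^ 2))
      ((1 - s * (2 * s / (s ^ 2 + w ^ 2))) / w) (-1 / (s ^ 2 + w ^ 2))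
      (s / (s ^ 2 + w ^ 2) / w) ?_ ?_ ?_ ?_ ?_⟩
    · have e : 2 * s / (s ^ 2 + w ^ 2) * (s / (s ^ 2 + w ^ 2) / w)
          - (1 - s * (2 * s / (s ^ 2 + w ^ 2))) / w * (-1 / (s ^ 2 + w ^ 2))
          = 1 / (w * (s ^ 2 + w ^ 2)) := by
        field_simp
        ring
      rw [e]
      positivity
    all_goals
      simp only [M6, M65, cubicModel, Matrix.cons_val]
      constructor <;> field_simp <;> ring
  -- a double root `s`: the dual numbers, whose unit becomes `∂₁`
  · obtain ⟨s, rfl⟩ : ∃ s, d = 2 * s := ⟨d / 2, by ring⟩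
    obtain rfl : c = -s ^ 2 := by linarith
    have hs : s ≠ 0 := by
      rintro rfl
      simp at hc
    refine ⟨1, linEquivA_of_columns (2 / s) (-s) (-1 / s ^ 2) 1 ?_ ?_ ?_ ?_ ?_⟩
    · have e : 2 / s * 1 - -s * (-1 / s ^ 2) = 1 / s := by
        field_simp
        ring
      rw [e]
      exact one_div_ne_zero hs
    all_goals
      simp only [M6, M61, cubicModel, Matrix.cons_val]
      constructor <;> field_simp <;> ring
  -- real roots `l`, `m`: the idempotents of `ℝ × ℝ` become `-∂₁` and `∂₂`
  · obtain ⟨w, hw, hw2⟩ : ∃ w : ℝ, 0 < w ∧ w ^ 2 = d ^ 2 + 4 * c :=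
      ⟨√(d ^ 2 + 4 * c), Real.sqrt_pos.2 hD, Real.sq_sqrt hD.le⟩
    obtain ⟨l, hl⟩ : ∃ l, l = (d + w) / 2 := ⟨_, rfl⟩
    obtain ⟨m, hm⟩ : ∃ m, m = (d - w) / 2 := ⟨_, rfl⟩
    obtain rfl : d = l + m := by rw [hl, hm]; ring
    obtain rfl : w = l - m := by linarith
    obtain rfl : c = -(l * m) := by linear_combination -hw2 / 4
    have hlm : l - m ≠ 0 := hw.ne'
    have hl0 : l ≠ 0 := by rintro rfl; simp at hc
    have hm0 : m ≠ 0 := by rintro rfl; simp at hc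
    refine ⟨2, linEquivA_of_columns (m / (l * (l - m))) (l / (m * (l - m)))
      (-1 / (l * (l - m))) (-1 / (m * (l - m))) ?_ ?_ ?_ ?_ ?_⟩
    · have e : m / (l * (l - m)) * (-1 / (m * (l - m))) - l / (m * (l - m)) * (-1 / (l * (l - m)))
          = 1 / (l * m * (l - m)) := by
        field_simp
        ring
      rw [e]
      positivity
    all_goals
      simp only [M6, M62, cubicModel, Matrix.cons_val]
      constructor <;> field_simp <;> ring

/-- The `k`-th component of the square `∇_x x` of the constant field `x = (a, b)`. -/
def squareA (ξ : Fin 8 → ℝ) (a b : ℝ) (k : Fin 2) : ℝ :=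
  a * a * christoffelA ξ 0 0 k + a * b * christoffelA ξ 0 1 k + b * a * christoffelA ξ 1 0 k
    + b * b * christoffelA ξ 1 1 k

/-- If the Ricci tensor vanishes, then the product `∇_x y` is associative. If some `x` is not
proportional to its square, then `x` and its square are a basis in which the product has the shape
of `cubicModel`; otherwise the product is zero. -/
lemma classification_flat {ξ : Fin 8 → ℝ} (hT : ∀ i, torsionA ξ i = 0)
    (hR : ∀ i j, ricciA ξ i j = 0) : ∃ i : Fin 6, LinEquivA ξ (M6 i 0 0) := by
  by_cases H : ∃ a b, a * squareA ξ a b 1 - b * squareA ξ a b 0 ≠ 0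
  · obtain ⟨a, b, hab⟩ := H
    have hdet : !![a, squareA ξ a b 0; b, squareA ξ a b 1].det ≠ 0 := by
      rw [Matrix.det_fin_two_of]
      intro h
      exact hab (by linarith)
    obtain ⟨ξ', hξ, hrel⟩ := exists_linEquivA ξ _ hdet
    have hT' := torsion_eq_zero_of_transform hdet hrel hT
    have hR' : ∀ i j, ricciA ξ' i j = 0 := fun i j => by
      rw [ricci_transform hdet hrel]
      simp [hR]
    have sq := linEquivA_rel_iff.2 hrel 0 0
    have sq0 := sq 0
    have sq1 := sq 1
    simp only [Fin.sum_univ_two, Matrix.of_apply, Matrix.cons_val] at sq0 sq1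
    have sq0' := sq0.trans (show _ = squareA ξ a b 0 by rw [squareA]; ring)
    have sq1' := sq1.trans (show _ = squareA ξ a b 1 by rw [squareA]; ring)
    have x0 : christoffelA ξ' 0 0 0 = 0 := by
      refine (mul_eq_zero.1 ?_).resolve_left hab
      linear_combination squareA ξ a b 1 * sq0' - squareA ξ a b 0 * sq1'
    have x1 : christoffelA ξ' 0 0 1 - 1 = 0 := by
      refine (mul_eq_zero.1 ?_).resolve_left hab
      linear_combination a * sq1' - b * sq0'
    have R00 := hR' 0 0
    have R01 := hR' 0 1
    have S := christoffelA_comm hT'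
    have S0 := S 0
    have S1 := S 1
    simp only [ricciA, Fin.sum_univ_two, Matrix.trace, Matrix.diag_apply, Matrix.mul_apply,
      leftMul_apply] at R00 R01
    simp only [christoffelA, Matrix.cons_val] at x0 x1 R00 R01 S0 S1
    have x1 : ξ' 1 = 1 := by linarith
    simp only [S1, x0, x1] at R00 R01
    -- the components `(0, 0)` and `(0, 1)` of the Ricci tensor fix the remaining square
    have e : ξ' = cubicModel (ξ' 2) (ξ' 3) := by
      ext m
      fin_cases m <;> simp only [cubicModel, Matrix.cons_val, Fin.reduceFinMk, Fin.zero_eta,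
        Fin.mk_one, Fin.isValue]
      · exact x0
      · exact x1
      · exact S0
      · exact S1
      · linear_combination ξ' 3 * S0 - R01
      · linear_combination R00 - S0
    obtain ⟨i, hi⟩ := cubicModel_normalForm (ξ' 2) (ξ' 3)
    rw [← e] at hi
    exact ⟨i, hξ.symm.trans hi.symm⟩
  -- every vector is proportional to its square, so that `x y = (λ(x) y + λ(y) x) / 2`, and
  -- `λ = 0` by the vanishing of the Ricci tensor
  · push Not at H
    have R00 := hR 0 0
    have R01 := hR 0 1
    have R11 := hR 1 1
    have S0 := christoffelA_comm hT 0
    have S1 := christoffelA_comm hT 1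
    have H1 := H 1 0
    have H2 := H 0 1
    have H3 := H 1 1
    have H4 := H 1 (-1)
    simp only [ricciA, Fin.sum_univ_two, Matrix.trace, Matrix.diag_apply, Matrix.mul_apply,
      leftMul_apply] at R00 R01 R11
    simp only [squareA, christoffelA, Matrix.cons_val] at R00 R01 R11 S0 S1 H1 H2 H3 H4
    simp only [S0, S1] at R01 R11 H3 H4
    have e1 : ξ 1 = 0 := by linarith
    have e6 : ξ 6 = 0 := by linarith
    have e0 : ξ 0 = 2 * ξ 3 := by linarith
    have e7 : ξ 7 = 2 * ξ 2 := by linarith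
    simp only [e0, e1, e6, e7] at R00 R11
    have e3 : ξ 3 = 0 := by nlinarith
    have e2 : ξ 2 = 0 := by nlinarith
    refine ⟨0, ?_⟩
    have : ξ = M6 0 0 0 := by
      ext m
      fin_cases m <;> simp [M6, M60, S0, S1, e0, e1, e2, e3, e6, e7]
    exact this ▸ LinEquivA.refl _

/-! ### Generic models -/

/-- `T¹ (∇_T T)² - T² (∇_T T)¹`, which vanishes exactly if `T` and `∇_T T` are proportional. -/
def torsionPolynomial : MvPolynomial (Fin 8) ℝ :=
  let T0 : MvPolynomial (Fin 8) ℝ := .X 2 - .X 4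
  let T1 : MvPolynomial (Fin 8) ℝ := .X 3 - .X 5
  T0 * (T0 * T0 * .X 1 + T0 * T1 * .X 3 + T1 * T0 * .X 5 + T1 * T1 * .X 7)
    - T1 * (T0 * T0 * .X 0 + T0 * T1 * .X 2 + T1 * T0 * .X 4 + T1 * T1 * .X 6)

lemma eval_torsionPolynomial (ξ : Fin 8 → ℝ) : MvPolynomial.eval ξ torsionPolynomial =
    8 * (torsionA ξ 0 * squareA ξ (torsionA ξ 0) (torsionA ξ 1) 1
      - torsionA ξ 1 * squareA ξ (torsionA ξ 0) (torsionA ξ 1) 0) := by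
  simp [torsionPolynomial, torsionA, squareA, christoffelA]
  ring

lemma torsionPolynomial_ne_zero : torsionPolynomial ≠ 0 := by
  intro h
  have := eval_torsionPolynomial ![0, 1, 1, 0, -1, 0, 0, 0]
  rw [h, map_zero] at this
  simp only [torsionA, squareA, christoffelA, Matrix.cons_val] at this
  norm_num at this

/-- The derivative `A` of a Killing field satisfies `A T = tr(A) T`, and so does the derivative of
`A` in the direction of `T`. Hence the Killing equations give
`A (∇_T T) = 2 tr(A) ∇_T T + r T` for some `r`, so that in the basis `T`, `∇_T T` the matrix of `A`
is triangular with trace `3 tr(A)`; it follows that `A = 0`. -/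
lemma eq_translations_of_generic {ξ : Fin 8 → ℝ}
    (hp : MvPolynomial.eval ξ torsionPolynomial ≠ 0) : (killingA ξ).toSubmodule = translations := by
  refine le_antisymm (fun v hv => mem_translations_iff.2 ?_) (translations_le ξ)
  rw [eval_torsionPolynomial] at hp
  have hp := right_ne_zero_of_mul hp
  have hc := contDiff_component v.contDiff
  have hc1 := fun k i => contDiff_pd (hc k) i
  have hτ := torsion_killing v.contDiff hv
  have K : ∀ i j k x, _ := isAffineKilling_modelA_iff.1 hv
  have dτ : ∀ m k x, torsionA ξ 0 * pd m (pd 0 (fun y => v.1 y k)) x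
      + torsionA ξ 1 * pd m (pd 1 (fun y => v.1 y k)) x = torsionA ξ k *
        (pd m (pd 0 (fun y => v.1 y 0)) x + pd m (pd 1 (fun y => v.1 y 1)) x) := by
    intro m k x
    have e : (fun y => torsionA ξ 0 * pd 0 (fun y => v.1 y k) y
        + torsionA ξ 1 * pd 1 (fun y => v.1 y k) y) = fun y => torsionA ξ k *
        (pd 0 (fun y => v.1 y 0) y + pd 1 (fun y => v.1 y 1) y) := by
      funext y
      simpa only [Fin.sum_univ_two] using hτ k y
    have e' := congrFun (congrArg (pd m) e) x
    simpa (disch := fun_prop) only [pd_add, pd_const_mul] using e'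
  simp only [Fin.sum_univ_two] at K hτ
  -- the Killing equations evaluated on the pair `(T, T)`
  have contract : ∀ k x, squareA ξ (torsionA ξ 0) (torsionA ξ 1) 0 * pd 0 (fun y => v.1 y k) x
      + squareA ξ (torsionA ξ 0) (torsionA ξ 1) 1 * pd 1 (fun y => v.1 y k) x =
      2 * (pd 0 (fun y => v.1 y 0) x + pd 1 (fun y => v.1 y 1) x)
        * squareA ξ (torsionA ξ 0) (torsionA ξ 1) k
      + torsionA ξ k * (torsionA ξ 0 * (pd 0 (pd 0 (fun y => v.1 y 0)) x
          + pd 0 (pd 1 (fun y => v.1 y 1)) x) + torsionA ξ 1 *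
          (pd 1 (pd 0 (fun y => v.1 y 0)) x + pd 1 (pd 1 (fun y => v.1 y 1)) x)) := by
    intro k x
    have d0 := dτ 0 k x
    have d1 := dτ 1 k x
    have a0 := hτ 0 x
    have a1 := hτ 1 x
    have K00 := K 0 0 k x
    have K01 := K 0 1 k x
    have K10 := K 1 0 k x
    have K11 := K 1 1 k x
    simp only [squareA]
    generalize torsionA ξ 0 = T0 at *
    generalize torsionA ξ 1 = T1 at *
    linear_combination T0 * d0 + T1 * d1 - T0 * T0 * K00 - T0 * T1 * K01 - T1 * T0 * K10
      - T1 * T1 * K11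
      + (2 * T0 * christoffelA ξ 0 0 k + T1 * (christoffelA ξ 0 1 k + christoffelA ξ 1 0 k)) * a0
      + (2 * T1 * christoffelA ξ 1 1 k + T0 * (christoffelA ξ 0 1 k + christoffelA ξ 1 0 k)) * a1
  have hβ : ∀ x, pd 0 (fun y => v.1 y 0) x + pd 1 (fun y => v.1 y 1) x = 0 := by
    intro x
    have a0 := hτ 0 x
    have a1 := hτ 1 x
    have e0 := contract 0 x
    have e1 := contract 1 x
    refine (mul_eq_zero.1 ?_).resolve_left hp
    generalize squareA ξ (torsionA ξ 0) (torsionA ξ 1) 0 = G0 at *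
    generalize squareA ξ (torsionA ξ 0) (torsionA ξ 1) 1 = G1 at *
    generalize torsionA ξ 0 = T0 at *
    generalize torsionA ξ 1 = T1 at *
    linear_combination (G0 * a1 - G1 * a0 + T1 * e0 - T0 * e1) / 2
  have dβ : ∀ m x, pd m (pd 0 (fun y => v.1 y 0)) x + pd m (pd 1 (fun y => v.1 y 1)) x = 0 := by
    intro m x
    have e := congrFun (congrArg (pd m) (funext hβ)) x
    simpa (disch := fun_prop) only [pd_add, pd_zero] using e
  have aT : ∀ k x, _ = (0 : ℝ) := fun k x => (hτ k x).trans (by rw [hβ, mul_zero])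
  have aG : ∀ k x, _ = (0 : ℝ) := fun k x => (contract k x).trans (by rw [hβ, dβ, dβ]; ring)
  refine Fin.forall_fin_two.2 ⟨fun k x => ?_, fun k x => ?_⟩ <;>
    refine (mul_eq_zero.1 ?_).resolve_left hp
  · linear_combination squareA ξ (torsionA ξ 0) (torsionA ξ 1) 1 * aT k x - torsionA ξ 1 * aG k x
  · linear_combination torsionA ξ 0 * aG k x - squareA ξ (torsionA ξ 0) (torsionA ξ 1) 0 * aT k x

/-! ### Models all of whose Killing fields are translations -/

/-- The coordinates of the abelian Lie algebra `KA`. -/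
def coordsKA : KA ≃ₗ[ℝ] (Fin 2 → ℝ) := LinearEquiv.refl ℝ (Fin 2 → ℝ)

lemma lieEquiv_KA {ξ : Fin 8 → ℝ} (h : (killingA ξ).toSubmodule = translations) :
    Nonempty (killingA ξ ≃ₗ⁅ℝ⁆ KA) := by
  let Φ : KA →ₗ⁅ℝ⁆ killingA ξ :=
    { toFun X := ⟨⟨fun _ => coordsKA X, mem_smoothFields.2 contDiff_const⟩, by
        rw [← LieSubalgebra.mem_toSubmodule, h, mem_translations_iff]
        exact fun i k x => congrFun (pd_const _ i) x⟩
      map_add' _ _ := rfl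
      map_smul' _ _ := rfl
      map_lie' {X Y} := by
        apply Subtype.ext
        apply Subtype.ext
        funext x k
        have e : coordsKA ⁅X, Y⁆ = 0 := by
          ext k
          fin_cases k <;> rfl
        simp [SmoothField.coe_bracket, VectorField.lieBracket, e] }
  refine ⟨(LieEquiv.ofBijective Φ ⟨fun X Y hXY => coordsKA.injective ?_, fun v => ?_⟩).symm⟩
  · exact congrFun (congrArg (fun v : killingA ξ => v.1.1) hXY) 0
  · have hv : v.1 ∈ translations := h ▸ v.2
    refine ⟨coordsKA.symm (v.1.1 0), Subtype.ext (Subtype.ext (funext fun x => ?_))⟩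
    exact const_of_pd v.1.contDiff (mem_translations_iff.1 hv) 0 x

lemma finrank_translations : Module.finrank ℝ translations = 2 := by
  have : LinearIndependent ℝ coordField := by
    rw [Fintype.linearIndependent_iff]
    intro g hg i
    have e := congrFun (congrFun (congrArg Subtype.val hg) 0) i
    fin_cases i <;> simpa [coordField, Fin.sum_univ_two] using e
  have e := finrank_span_eq_card this
  have hr : Set.range coordField = {coordField 0, coordField 1} := by
    ext v
    simp [Fin.exists_fin_two, eq_comm]
  rwa [hr, Fintype.card_fin] at e

lemma eq_translations_of_rank_le {ξ : Fin 8 → ℝ} (h : ¬ 2 < Module.rank ℝ (killingA ξ)) :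
    (killingA ξ).toSubmodule = translations := by
  have : FiniteDimensional ℝ (killingA ξ).toSubmodule :=
    inferInstanceAs (FiniteDimensional ℝ (killingA ξ))
  refine (Submodule.eq_of_le_of_finrank_le (translations_le ξ) ?_).symm
  rw [finrank_translations]
  exact Module.finrank_le_of_rank_le (not_lt.1 h)

end

theorem mainTheorem4 :
    -- generically the algebra consists of the translations and is isomorphic to `𝔎_A`
    (∃ p : MvPolynomial (Fin 8) ℝ, p ≠ 0 ∧ ∀ ξ : Fin 8 → ℝ, MvPolynomial.eval ξ p ≠ 0 →
      (killingA ξ).toSubmodule = translations ∧ Nonempty (killingA ξ ≃ₗ⁅ℝ⁆ KA)) ∧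
    -- this happens for every Type A model whose algebra has dimension at most two
    (∀ ξ : Fin 8 → ℝ, ¬ 2 < Module.rank ℝ (killingA ξ) →
      (killingA ξ).toSubmodule = translations ∧ Nonempty (killingA ξ ≃ₗ⁅ℝ⁆ KA)) ∧
    -- every Type A model whose algebra has dimension greater than two is listed
    (∀ ξ : Fin 8 → ℝ, 2 < Module.rank ℝ (killingA ξ) →
      ((∀ i, torsionA ξ i = 0) ∧
        (∃ i : Fin 6, LinEquivA ξ (M6 i 0 0)) ∧
        Nonempty (killingA ξ ≃ₗ⁅ℝ⁆ A6)) ∨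
      (((∃ ε : ℝ, ε ≠ 0 ∧
            (LinEquivA ξ (M61 0 ε) ∨ LinEquivA ξ (M62 0 ε) ∨ LinEquivA ξ (M62 ε 0) ∨
              LinEquivA ξ (M63 ε 0))) ∨
          (∃ c t : ℝ, c ≠ 0 ∧ c ≠ -1 ∧
            (LinEquivA ξ (M42 c t 0) ∨ LinEquivA ξ (M43 c t 0)))) ∧
        Nonempty (killingA ξ ≃ₗ⁅ℝ⁆ KB × KB)) ∨
      (((∃ ε₁ ε₂ : ℝ, (ε₁, ε₂) ≠ (0, 0) ∧ LinEquivA ξ (M60 ε₁ ε₂)) ∨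
          (∃ ε : ℝ, ε ≠ 0 ∧ (LinEquivA ξ (M63 0 ε) ∨ LinEquivA ξ (M64 ε 0))) ∨
          (∃ t : ℝ, LinEquivA ξ (M41 t 0)) ∨
          (∃ c t : ℝ, LinEquivA ξ (M44 c t 0))) ∧
        Nonempty (killingA ξ ≃ₗ⁅ℝ⁆ A49)) ∨
      ((∃ c t : ℝ, LinEquivA ξ (M45 c t 0)) ∧
        Nonempty (killingA ξ ≃ₗ⁅ℝ⁆ A412))) ∧
    -- the flat torsion free models
    (∀ i : Fin 6, Nonempty (killingA (M6 i 0 0) ≃ₗ⁅ℝ⁆ A6)) ∧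
    -- the models of type `𝔎_B ⊕ 𝔎_B`
    (∀ ε : ℝ, ε ≠ 0 →
      Nonempty (killingA (M61 0 ε) ≃ₗ⁅ℝ⁆ KB × KB) ∧
      Nonempty (killingA (M62 0 ε) ≃ₗ⁅ℝ⁆ KB × KB) ∧
      Nonempty (killingA (M62 ε 0) ≃ₗ⁅ℝ⁆ KB × KB) ∧
      Nonempty (killingA (M63 ε 0) ≃ₗ⁅ℝ⁆ KB × KB)) ∧
    (∀ c t : ℝ, c ≠ 0 → c ≠ -1 →
      Nonempty (killingA (M42 c t 0) ≃ₗ⁅ℝ⁆ KB × KB) ∧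
      Nonempty (killingA (M43 c t 0) ≃ₗ⁅ℝ⁆ KB × KB)) ∧
    -- the models of type `A⁰_{4,9}`
    (∀ ε₁ ε₂ : ℝ, (ε₁, ε₂) ≠ (0, 0) → Nonempty (killingA (M60 ε₁ ε₂) ≃ₗ⁅ℝ⁆ A49)) ∧
    (∀ ε : ℝ, ε ≠ 0 →
      Nonempty (killingA (M63 0 ε) ≃ₗ⁅ℝ⁆ A49) ∧
      Nonempty (killingA (M64 ε 0) ≃ₗ⁅ℝ⁆ A49)) ∧
    (∀ t : ℝ, Nonempty (killingA (M41 t 0) ≃ₗ⁅ℝ⁆ A49)) ∧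
    (∀ c t : ℝ, Nonempty (killingA (M44 c t 0) ≃ₗ⁅ℝ⁆ A49)) ∧
    -- the models of type `A_{4,12}`
    (∀ c t : ℝ, Nonempty (killingA (M45 c t 0) ≃ₗ⁅ℝ⁆ A412)) := by
  refine ⟨⟨torsionPolynomial, torsionPolynomial_ne_zero, fun ξ hp => ?_⟩, fun ξ h => ?_,
    fun ξ h => ?_, M6_lieEquiv, fun ε hε => ?_, fun c t h0 h1 => ?_, fun ε₁ ε₂ hε => ?_,
    fun ε hε => ?_, fun t => ?_, fun c t => ?_, fun c t => ?_⟩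
  · have e := eq_translations_of_generic hp
    exact ⟨e, lieEquiv_KA e⟩
  · have e := eq_translations_of_rank_le h
    exact ⟨e, lieEquiv_KA e⟩
  · by_cases hflat : (∀ i, torsionA ξ i = 0) ∧ ∀ i j, ricciA ξ i j = 0
    · obtain ⟨i, hi⟩ := classification_flat hflat.1 hflat.2
      exact Or.inl ⟨hflat.1, ⟨i, hi⟩, hi.nonempty_lieEquiv_trans (M6_lieEquiv i)⟩
    · have H : IsKBKBModel ξ ∨ IsA49Model ξ ∨ IsA412Model ξ := by
        by_cases hT : ∀ i, torsionA ξ i = 0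
        · have hR : ¬ ∀ i j, ricciA ξ i j = 0 := fun hR => hflat ⟨hT, hR⟩
          push Not at hR
          exact classification_ricci hT hR h
        · push Not at hT
          exact classification_torsion hT h
      exact Or.inr (H.imp (fun H => ⟨H, IsKBKBModel.lieEquiv H⟩)
        (.imp (fun H => ⟨H, IsA49Model.lieEquiv H⟩) (fun H => ⟨H, IsA412Model.lieEquiv H⟩)))
  · have of := fun {ξ} h => IsKBKBModel.lieEquiv (ξ := ξ) (Or.inl ⟨ε, hε, h⟩)
    exact ⟨of (Or.inl (.refl _)), of (Or.inr (Or.inl (.refl _))),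
      of (Or.inr (Or.inr (Or.inl (.refl _)))), of (Or.inr (Or.inr (Or.inr (.refl _))))⟩
  · have of := fun {ξ} h => IsKBKBModel.lieEquiv (ξ := ξ) (Or.inr ⟨c, t, h0, h1, h⟩)
    exact ⟨of (Or.inl (.refl _)), of (Or.inr (.refl _))⟩
  · exact IsA49Model.lieEquiv (Or.inl ⟨ε₁, ε₂, hε, .refl _⟩)
  · have of := fun {ξ} h => IsA49Model.lieEquiv (ξ := ξ) (Or.inr (Or.inl ⟨ε, hε, h⟩))
    exact ⟨of (Or.inl (.refl _)), of (Or.inr (.refl _))⟩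
  · exact IsA49Model.lieEquiv (Or.inr (Or.inr (Or.inl ⟨t, .refl _⟩)))
  · exact IsA49Model.lieEquiv (Or.inr (Or.inr (Or.inr ⟨c, t, .refl _⟩)))
  · exact IsA412Model.lieEquiv ⟨c, t, .refl _⟩
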